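/- Let $\mathcal E,\mu,\omega>0$, $\mathcal E+h>0$, $2\mathcal E>\omega^2$, $0\le e<1$, $b=\sqrt{1-e^2}$. Let $D=\{(x,y): x^2+y^2/b^2<1\}$, with boundary parametrised by $\gamma(\xi)=(\cos\xi,\,b\sin\xi)$. Consider the zero-energy dynamics in the plane with the potential $$V_I(z)=\mathcal E+h+\frac{\mu}{|z|}\ \text{ in } D,\qquad V_E(z)=\mathcal E-\frac{\omega^2}{2}|z|^2\ \text{ outside } D,$$ that is, outer arcs solve $z''=\nabla V_E(z)$, $\tfrac12|z'|^2=V_E(z)$; inner arcs solve $z''=\nabla V_I(z)$, $\tfrac12|z'|^2=V_I(z)$, and are continued through collisions with the origin by Levi-Civita regularisation ($z=w^2$, $ds=2|z|\,d\tau$, $w''=2(\mathcal E+h)w$, where $s$ is the physical time, $w''$ is the second derivative in $\tau$, and $\tfrac12|w'|^2-(\mathcal E+h)|w|^2=\mu$); at each crossing of $\partial D$ the velocities $v_E,v_I$ on the two sides satisfy Snell's law $\sqrt{V_E}\,\frac{v_E}{|v_E|}\cdot t=\sqrt{V_I}\,\frac{v_I}{|v_I|}\cdot t$, where $t$ is the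 unit tangent to $\partial D$. Let $F:(\xi_0,\alpha_0)\mapsto(\xi_1,\alpha_1)$ be the first return map, which sends the starting point $\gamma(\xi_0)$ and the angle $\alpha_0\in[-\pi/2,\pi/2]$, measured from the outward normal, of the initial velocity of an outer arc to the corresponding data after one outer arc followed by one inner arc ($\xi$ is taken modulo $2\pi$). Let $\bar\xi_0=0$ and $\bar\xi_1=\pi/2$. For $i=0,1$ there is a homothetic orbit in the direction of $\gamma(\bar\xi_i)$ (denoted $\bar z_0$ for $i=0$ and $\bar z_{\pi/2}$ for $i=1$), with both arcs on the ray from the origin through $\gamma(\bar\xi_i)$. The map $F$ is well defined near $(\bar\xi_i,0)$, which is a fixed point of $F$ corresponding to this orbit, and $F$ is differentiable there. The discriminant $\Delta^{(i)}$ of the characteristic polynomial of $DF(\bar\xi_i,0)$ is $\Delta^{(i)}=A^{(i)}B^{(i)}C^{(i)}D^{(i)}$, where, with $v_E^{(i)}=\sqrt{V_E(\gamma(\bar\xi_i))}$ and $v_I^{(i)}=\sqrt{V_I(\gamma(\bar\xi_i))}$, $$\begin{aligned} A^{(0)}&=-\tfrac{16}{\mathcal E^2\mu^2}\tfrac{e^2}{1-e^2}\bigl(v_E^{(0)}-v_I^{(0)}\bigr),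 & A^{(1)}&=\tfrac{16e^2}{\mathcal E^2\mu^2}\bigl(v_E^{(1)}-v_I^{(1)}\bigr),\\ B^{(0)}&=\mu+\tfrac{2e^2}{1-e^2}v_I^{(0)}\bigl(v_I^{(0)}-v_E^{(0)}\bigr), & B^{(1)}&=\mu-2e^2\sqrt{1-e^2}\,v_I^{(1)}\bigl(v_I^{(1)}-v_E^{(1)}\bigr),\\ C^{(0)}&=\mathcal E+\tfrac{e^2}{1-e^2}v_E^{(0)}\bigl(v_E^{(0)}-v_I^{(0)}\bigr), & C^{(1)}&=\mathcal E-e^2v_E^{(1)}\bigl(v_E^{(1)}-v_I^{(1)}\bigr),\\ D^{(0)}&=-\mu v_E^{(0)}+2v_I^{(0)}C^{(0)}, & D^{(1)}&=-\mu v_E^{(1)}+2\sqrt{1-e^2}\,v_I^{(1)}C^{(1)}. \end{aligned}$$ These values agree with the general formula $$\Delta(\xi)=\tfrac{16}{\mathcal E^2\mu^2}(v_I-v_E)\,\kappa\cdot B\cdot\bigl(-\mu v_E+2rBv_I\bigr)\cdot\bigl(\mu+2r\kappa v_I(v_I-v_E)\bigr),\qquad B=\mathcal E-\kappa(v_I-v_E)v_E,$$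 at $\xi=\bar\xi_i$, where $v_I=\sqrt{V_I(\gamma(\xi))}$, $v_E=\sqrt{V_E(\gamma(\xi))}$, $r=|\gamma(\xi)|$, $\kappa=rk(\xi)-1$, and $k$ is the curvature of $\gamma$. Moreover, $\Delta^{(i)}>0$ if and only if $(\bar\xi_i,0)$ is a linear saddle ($DF(\bar\xi_i,0)$ has real eigenvalues $\lambda,1/\lambda$ with $|\lambda|>1$), and then the orbit is linearly unstable (the iterates of $DF(\bar\xi_i,0)$ are unbounded); $\Delta^{(i)}<0$ if and only if $(\bar\xi_i,0)$ is a linear center (the eigenvalues of $DF(\bar\xi_i,0)$ are non-real, complex conjugate and of modulus $1$), and then the orbit is linearly stable (the iterates are bounded). -/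

import Mathlib

noncomputable section

namespace RefractionGalaxy

/-! The plane is identified with `ℂ`. The parameters are `E` (the energy), `h`, `μ`, `ω`. -/

/-- The inner (Keplerian) potential `E + h + μ / |z|`. -/
def innerPotential (E h μ : ℝ) (z : ℂ) : ℝ := E + h + μ / ‖z‖

/-- The outer (harmonic) potential `E - (ω² / 2) |z|²`. -/
def outerPotential (E ω : ℝ) (z : ℂ) : ℝ := E - ω ^ 2 / 2 * ‖z‖ ^ 2

/-- `y` is an outer arc of zero energy on `[0, T]`, with velocity `y'`: it solves
`y'' = - ω² y`, `|y'|² / 2 = V_E(y)`, and it stays outside the closure of `D` on `(0, T)`. -/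
structure IsOuterArc (E ω : ℝ) (D : Set ℂ) (y y' : ℝ → ℂ) (T : ℝ) : Prop where
  pos : 0 < T
  deriv_pos : ∀ s ∈ Set.Icc 0 T, HasDerivWithinAt y (y' s) (Set.Icc 0 T) s
  deriv_vel : ∀ s ∈ Set.Icc 0 T, HasDerivWithinAt y' (-(ω : ℂ) ^ 2 * y s) (Set.Icc 0 T) s
  energy : ∀ s ∈ Set.Icc 0 T, ‖y' s‖ ^ 2 / 2 - outerPotential E ω (y s) = 0
  outside : ∀ s ∈ Set.Ioo 0 T, y s ∉ closure D

/-- `w` is a regularised inner arc of zero energy on `[0, T]`, written in the Levi-Civita variable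
`w` with Levi-Civita time `τ`, with `w'` the derivative of `w` in `τ`:
`w'' = Ω² w`, `|w'|² / 2 - Ω² |w|² / 2 = μ`, where `Ω² = 2 (E + h)`.
The physical position is `z = w²`, the physical time `s` satisfies `ds = 2 |z| dτ`, and the
physical velocity `dz / ds` is `w' / conj w`. Away from the collision `z = 0` this is the zero
energy Kepler problem `z'' = - μ z / |z|³`, `|z'|² / 2 = V_I(z)`
(see `IsInnerArc.kepler` below); through a collision it is the regularised flow. The position `w²`
stays in `D` on `(0, T)`. -/
structure IsInnerArc (E h μ : ℝ) (D : Set ℂ) (w w' : ℝ → ℂ) (T : ℝ) : Prop where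
  pos : 0 < T
  deriv_pos : ∀ τ ∈ Set.Icc 0 T, HasDerivWithinAt w (w' τ) (Set.Icc 0 T) τ
  deriv_vel : ∀ τ ∈ Set.Icc 0 T,
    HasDerivWithinAt w' (((2 * (E + h) : ℝ) : ℂ) * w τ) (Set.Icc 0 T) τ
  energy : ∀ τ ∈ Set.Icc 0 T, ‖w' τ‖ ^ 2 / 2 - (2 * (E + h)) / 2 * ‖w τ‖ ^ 2 - μ = 0
  inside : ∀ τ ∈ Set.Ioo 0 T, w τ ^ 2 ∈ D

/-- The position of a regularised inner arc. -/
def innerPos (w : ℝ → ℂ) (τ : ℝ) : ℂ := w τ ^ 2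

/-- The physical velocity of a regularised inner arc. -/
def innerVel (w w' : ℝ → ℂ) (τ : ℝ) : ℂ := w' τ / (starRingEnd ℂ) (w τ)

/-- Away from collisions a regularised inner arc solves the zero energy Kepler problem, in the
physical time `s` with `ds = 2 |z| dτ`. -/
theorem IsInnerArc.kepler {E h μ : ℝ} {D : Set ℂ} {w w' : ℝ → ℂ} {T : ℝ}
    (H : IsInnerArc E h μ D w w' T) {τ : ℝ} (hτ : τ ∈ Set.Icc 0 T) (h0 : w τ ≠ 0) :
    HasDerivWithinAt (innerPos w) ((2 * ‖innerPos w τ‖ : ℝ) * innerVel w w' τ) (Set.Icc 0 T) τ ∧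
    HasDerivWithinAt (innerVel w w')
      ((2 * ‖innerPos w τ‖ : ℝ) * (-(μ : ℂ) / (‖innerPos w τ‖ : ℂ) ^ 3 * innerPos w τ))
      (Set.Icc 0 T) τ ∧
    ‖innerVel w w' τ‖ ^ 2 / 2 - innerPotential E h μ (innerPos w τ) = 0 := by
  have hc : (starRingEnd ℂ) (w τ) ≠ 0 := by simpa using h0
  have hn : (‖w τ‖ : ℂ) ≠ 0 := by simpa using h0
  have hw := H.deriv_pos τ hτ
  have hw' := H.deriv_vel τ hτ
  have hen := H.energy τ hτ
  have hmul : w τ * (starRingEnd ℂ) (w τ) = (‖w τ‖ : ℂ) ^ 2 := Complex.mul_conj' _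
  have hmul' : w' τ * (starRingEnd ℂ) (w' τ) = (‖w' τ‖ : ℂ) ^ 2 := Complex.mul_conj' _
  have henC : (‖w' τ‖ : ℂ) ^ 2 = 2 * (E + h) * (‖w τ‖ : ℂ) ^ 2 + 2 * μ := by
    have : ‖w' τ‖ ^ 2 = 2 * (E + h) * ‖w τ‖ ^ 2 + 2 * μ := by linarith
    exact_mod_cast this
  have hconj : HasDerivWithinAt (fun x => (starRingEnd ℂ) (w x)) ((starRingEnd ℂ) (w' τ))
      (Set.Icc 0 T) τ := by
    simpa using hw.star
  refine ⟨?_, ?_, ?_⟩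
  · refine (hw.pow 2).congr_deriv ?_
    simp only [innerPos, innerVel, norm_pow]
    push_cast
    rw [← hmul]
    field_simp
  · refine (hw'.div hconj hc).congr_deriv ?_
    simp only [innerPos, norm_pow]
    push_cast
    rw [hmul', henC, ← hmul]
    field_simp
    ring
  · have hr : ‖w τ‖ ≠ 0 := by simpa using h0
    simp only [innerVel, innerPos, innerPotential, norm_div, norm_pow, RCLike.norm_conj]
    field_simp
    linarith

/-- The unit tangent vector of a regular curve. -/
def unitTangent (γ : ℝ → ℂ) (ξ : ℝ) : ℂ := deriv γ ξ / (‖deriv γ ξ‖ : ℂ)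

/-- The outward unit normal of a positively oriented closed curve. -/
def unitNormal (γ : ℝ → ℂ) (ξ : ℝ) : ℂ := -Complex.I * unitTangent γ ξ

/-- The velocity of an outer arc leaving `γ ξ` at the angle `α` with the outward normal. -/
def launchVel (E ω : ℝ) (γ : ℝ → ℂ) (p : ℝ × ℝ) : ℂ :=
  (Real.sqrt (2 * outerPotential E ω (γ p.1)) : ℂ) *
    ((Real.cos p.2 : ℂ) * unitNormal γ p.1 + (Real.sin p.2 : ℂ) * unitTangent γ p.1)

/-- Snell's law at the point `γ ξ` for an outer velocity `vE` and an inner velocity `vI`: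
`√V_E (vE / |vE|) · t = √V_I (vI / |vI|) · t` with `t` the unit tangent. -/
def Snell (E h μ ω : ℝ) (γ : ℝ → ℂ) (ξ : ℝ) (vE vI : ℂ) : Prop :=
  Real.sqrt (outerPotential E ω (γ ξ)) * inner ℝ (vE / (‖vE‖ : ℂ)) (unitTangent γ ξ) =
    Real.sqrt (innerPotential E h μ (γ ξ)) * inner ℝ (vI / (‖vI‖ : ℂ)) (unitTangent γ ξ)

/-- One full cycle of the dynamics. From the state `p = (ξ₀, α₀)` an outer arc `y` leaves `γ ξ₀` at
the angle `α₀` with the outward normal, comes back to the boundary at time `TE`, is refracted into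
an inner arc `w`, which meets the boundary at `γ ξ₁` (at Levi-Civita time `TI`) and is refracted
out at the angle `α₁`; the final state is `q = (ξ₁, α₁)`. -/
structure IsCycle (E h μ ω : ℝ) (D : Set ℂ) (γ : ℝ → ℂ) (p q : ℝ × ℝ)
    (y y' : ℝ → ℂ) (TE : ℝ) (w w' : ℝ → ℂ) (TI : ℝ) : Prop where
  outer : IsOuterArc E ω D y y' TE
  inner : IsInnerArc E h μ D w w' TI
  angle_start : p.2 ∈ Set.Icc (-(Real.pi / 2)) (Real.pi / 2)
  angle_end : q.2 ∈ Set.Icc (-(Real.pi / 2)) (Real.pi / 2)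
  start_pos : y 0 = γ p.1
  start_vel : y' 0 = launchVel E ω γ p
  junction : ∃ ξ : ℝ, y TE = γ ξ ∧ innerPos w 0 = γ ξ ∧
    Snell E h μ ω γ ξ (y' TE) (innerVel w w' 0)
  end_pos : innerPos w TI = γ q.1
  end_vel : Snell E h μ ω γ q.1 (launchVel E ω γ q) (innerVel w w' TI)

/-- `q` is the state after one cycle that starts from the state `p`. -/
def IsReturn (E h μ ω : ℝ) (D : Set ℂ) (γ : ℝ → ℂ) (p q : ℝ × ℝ) : Prop :=
  ∃ (y y' : ℝ → ℂ) (TE : ℝ) (w w' : ℝ → ℂ) (TI : ℝ), IsCycle E h μ ω D γ p q y y' TE w w' TI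

/-- There is a homothetic one-periodic (collision) orbit in the direction of `γ ξ`: a cycle from
`(ξ, 0)` to itself, both arcs of which lie on the ray from the origin through `γ ξ`. -/
def HasHomotheticOrbit (E h μ ω : ℝ) (D : Set ℂ) (γ : ℝ → ℂ) (ξ : ℝ) : Prop :=
  ∃ (y y' : ℝ → ℂ) (TE : ℝ) (w w' : ℝ → ℂ) (TI : ℝ),
    IsCycle E h μ ω D γ (ξ, 0) (ξ, 0) y y' TE w w' TI ∧
    (∀ s ∈ Set.Icc 0 TE, ∃ r : ℝ, 0 ≤ r ∧ y s = (r : ℂ) * γ ξ) ∧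
    (∀ τ ∈ Set.Icc 0 TI, ∃ r : ℝ, 0 ≤ r ∧ innerPos w τ = (r : ℂ) * γ ξ)

/-- `F` is a local first return map near its fixed point `p`: for every state near `p` the state
after one cycle exists, is unique (as a point of the boundary with an angle), and is given by `F`.
Near `p` such an `F` is unique, by continuity at `p`. -/
structure IsLocalReturnMap (E h μ ω : ℝ) (D : Set ℂ) (γ : ℝ → ℂ) (p : ℝ × ℝ)
    (F : ℝ × ℝ → ℝ × ℝ) : Prop where
  continuousAt : ContinuousAt F p
  fixed : F p = p
  return_iff : ∀ᶠ x in nhds p, ∀ q : ℝ × ℝ,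
    IsReturn E h μ ω D γ x q ↔ (γ q.1 = γ (F x).1 ∧ q.2 = (F x).2)

/-- The discriminant `b² - 4 a c` of the characteristic polynomial `a λ² + b λ + c` of `A`. -/
def charDiscr (A : (ℝ × ℝ) →L[ℝ] (ℝ × ℝ)) : ℝ :=
  let P := (A : (ℝ × ℝ) →ₗ[ℝ] (ℝ × ℝ)).charpoly
  discrim (P.coeff 2) (P.coeff 1) (P.coeff 0)

/-- Linear saddle: real eigenvalues `λ`, `1 / λ` with `|λ| > 1`. -/
def IsSaddle (A : (ℝ × ℝ) →L[ℝ] (ℝ × ℝ)) : Prop :=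
  ∃ l : ℝ, 1 < |l| ∧
    Module.End.HasEigenvalue (A : (ℝ × ℝ) →ₗ[ℝ] (ℝ × ℝ)) l ∧
    Module.End.HasEigenvalue (A : (ℝ × ℝ) →ₗ[ℝ] (ℝ × ℝ)) l⁻¹

/-- Linear center: the eigenvalues are a pair of non-real complex conjugate numbers on the unit
circle. -/
def IsCenter (A : (ℝ × ℝ) →L[ℝ] (ℝ × ℝ)) : Prop :=
  ∃ l : ℂ, l.im ≠ 0 ∧ ‖l‖ = 1 ∧
    ((A : (ℝ × ℝ) →ₗ[ℝ] (ℝ × ℝ)).charpoly.map (algebraMap ℝ ℂ)).roots =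
      {l, (starRingEnd ℂ) l}

/-- Stability of the linear map `A` at the origin: the iterates of `A` are uniformly bounded. -/
def IsLinearlyStable (A : (ℝ × ℝ) →L[ℝ] (ℝ × ℝ)) : Prop :=
  ∃ C : ℝ, ∀ (n : ℕ) (v : ℝ × ℝ), ‖(A ^ n) v‖ ≤ C * ‖v‖

/-- The signed curvature of a planar curve. -/
def curvature (γ : ℝ → ℂ) (ξ : ℝ) : ℝ :=
  ((starRingEnd ℂ) (deriv γ ξ) * deriv (deriv γ) ξ).im / ‖deriv γ ξ‖ ^ 3

/-- The discriminant of the homothetic orbit through `γ ξ` for a general boundary curve, in terms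
of the potentials, the distance to the origin and the curvature at `γ ξ`. -/
def deltaGeneral (E h μ ω : ℝ) (γ : ℝ → ℂ) (ξ : ℝ) : ℝ :=
  let vI := Real.sqrt (innerPotential E h μ (γ ξ))
  let vE := Real.sqrt (outerPotential E ω (γ ξ))
  let r := ‖γ ξ‖
  let κ := r * curvature γ ξ - 1
  let A := 16 / (E ^ 2 * μ ^ 2) * (vI - vE) * κ
  let B := E - κ * (vI - vE) * vE
  let C := -μ * vE + 2 * r * B * vI
  let D := μ + 2 * r * κ * vI * (vI - vE)
  A * B * C * D

/-- The open elliptic domain with semiaxes `1` and `√(1 - e²)`. -/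
def ellipseDomain (e : ℝ) : Set ℂ := {z | z.re ^ 2 + z.im ^ 2 / (1 - e ^ 2) < 1}

/-- The ellipse `ξ ↦ (cos ξ, √(1 - e²) sin ξ)`, the boundary of `ellipseDomain e`. -/
def ellipse (e : ℝ) (ξ : ℝ) : ℂ :=
  (Real.cos ξ : ℂ) + ((Real.sqrt (1 - e ^ 2) * Real.sin ξ : ℝ) : ℂ) * Complex.I

/-- The explicit discriminant at the orbit in the direction of the semiaxis of length `1`. -/
def delta0 (E h μ ω e : ℝ) : ℝ :=
  let vE := Real.sqrt (outerPotential E ω (ellipse e 0))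
  let vI := Real.sqrt (innerPotential E h μ (ellipse e 0))
  let A := -(16 / (E ^ 2 * μ ^ 2)) * (e ^ 2 / (1 - e ^ 2)) * (vE - vI)
  let B := μ + 2 * (e ^ 2 / (1 - e ^ 2)) * vI * (vI - vE)
  let C := E + e ^ 2 / (1 - e ^ 2) * vE * (vE - vI)
  let D := -μ * vE + 2 * vI * C
  A * B * C * D

/-- The explicit discriminant at the orbit in the direction of the semiaxis of length
`√(1 - e²)`. -/
def delta1 (E h μ ω e : ℝ) : ℝ :=
  let vE := Real.sqrt (outerPotential E ω (ellipse e (Real.pi / 2)))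
  let vI := Real.sqrt (innerPotential E h μ (ellipse e (Real.pi / 2)))
  let A := 16 * e ^ 2 / (E ^ 2 * μ ^ 2) * (vE - vI)
  let B := μ - 2 * e ^ 2 * Real.sqrt (1 - e ^ 2) * vI * (vI - vE)
  let C := E - e ^ 2 * vE * (vE - vI)
  let D := -μ * vE + 2 * Real.sqrt (1 - e ^ 2) * vI * C
  A * B * C * D

end RefractionGalaxy

end

open RefractionGalaxy

/-! Both flows are linear: the outer one is harmonic, and the inner one is linear in the Levi-Civita
variable `w`. Near a homothetic orbit the return map is therefore explicit apart from the two
hitting times. It suffices to treat the vertex `a` of an ellipse with semiaxes `a`, `c`, with the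
reference orbit on the real axis. The other vertex of the given ellipse follows by a quarter turn,
which exchanges the semiaxes.

On the reference orbit positions and velocities are real and both crossings are perpendicular. The
boundary parameter and the tangential component of a direction are, to first order, read off from
imaginary parts. Changing the hitting time displaces the end point along the real axis, so only the
differentiability of the hitting time is needed, never its derivative. `exists_first_hit` supplies
it, together with the persistence of the arc on the correct side of the ellipse.

For inner arcs, `leviCivita_sq` writes the position as a real combination of `z`, `|z| v` and `v²
conj z`, where `z`, `v` are the initial data. No square root is left, and the collision causes no
singularity.

In the coordinates `(ξ, sin α)` each arc then has an explicit 2×2 derivative of determinant one with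
equal diagonal entries (`exists_outer_transition`, `exists_inner_transition`). Snell's law
multiplies the second coordinate by `vE / vI` on the way in and by `vI / vE` on the way out. The
product of these matrices has determinant one, and `trace² - 4` factors as claimed, with `κ = a² /
c² - 1` (`exists_returnMap`). A plane map of determinant one is a saddle or a center according to
the sign of `trace² - 4`. This settles the linear dynamics, since all local return maps have the
same germ (`homothetic_stability`). -/

/-! ### First hitting times. -/

open Filter Topology Set in
/-- First hitting times of a level set, transversal at both ends, persist and depend
differentiably on the parameter. -/
theorem exists_first_hit {X : Type*} [NormedAddCommGroup X] [NormedSpace ℝ X] [CompleteSpace X]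
    {G G₁ : X → ℝ → ℝ} {x₀ : X} {T₀ : ℝ} {f' : X × ℝ →L[ℝ] ℝ} (hT₀ : 0 < T₀)
    (hG : ∀ᶠ x in 𝓝 x₀, ∀ t, HasDerivAt (G x) (G₁ x t) t)
    (hcont : ∀ t ∈ Icc 0 T₀, ContinuousAt (Function.uncurry G) (x₀, t))
    (hc0 : ContinuousAt (Function.uncurry G₁) (x₀, 0))
    (hcT : ContinuousAt (Function.uncurry G₁) (x₀, T₀))
    (hs : HasStrictFDerivAt (Function.uncurry G) f' (x₀, T₀))
    (h0 : ∀ᶠ x in 𝓝 x₀, G x 0 = 0) (hpos0 : 0 < G₁ x₀ 0) (hneg : G₁ x₀ T₀ < 0)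
    (hT : G x₀ T₀ = 0) (hpos : ∀ t ∈ Ioo 0 T₀, 0 < G x₀ t) :
    ∃ T : X → ℝ, T x₀ = T₀ ∧ (∃ T' : X →L[ℝ] ℝ, HasStrictFDerivAt T T' x₀) ∧
      ∀ᶠ x in 𝓝 x₀, 0 < T x ∧ G x (T x) = 0 ∧ ∀ t ∈ Ioo 0 (T x), 0 < G x t := by
  have hpart : f' (0, 1) = G₁ x₀ T₀ := by
    have h1 : HasDerivAt (fun t : ℝ => (x₀, t)) ((0 : X), (1 : ℝ)) T₀ :=
      (hasDerivAt_const T₀ x₀).prodMk (hasDerivAt_id T₀)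
    have h2 := hs.hasFDerivAt.comp_hasDerivAt T₀ h1
    exact h2.unique (hG.self_of_nhds T₀)
  have hinv : (f' ∘L .inr ℝ X ℝ).IsInvertible := by
    have hne : G₁ x₀ T₀ ≠ 0 := hneg.ne
    refine ⟨ContinuousLinearEquiv.unitsEquivAut ℝ (Units.mk0 _ hne), ?_⟩
    ext
    simp [hpart]
  -- Transversality at `T₀` makes the time derivative invertible, so the implicit function theorem
  -- defines `T`. It remains to exclude earlier zeros: `G x` increases near `0`, is positive on a
  -- compact middle interval, and decreases near `T₀`.
  set T := hs.implicitFunctionOfProdDomain hinv with hTdef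
  have hTx₀ : T x₀ = T₀ :=
    (hs.eventually_apply_eq_iff_implicitFunctionOfProdDomain hinv).self_of_nhds.mp rfl
  have hTd := hs.hasStrictFDerivAt_implicitFunctionOfProdDomain hinv
  have hTt : Tendsto T (𝓝 x₀) (𝓝 T₀) := by
    have : Tendsto T (𝓝 x₀) (𝓝 (T x₀)) := hTd.continuousAt.tendsto
    rwa [hTx₀] at this
  have hzero : ∀ᶠ x in 𝓝 x₀, G x (T x) = 0 := by
    have := hs.eventually_apply_implicitFunctionOfProdDomain hinv
    filter_upwards [this] with x hx
    simpa [Function.uncurry, hT] using hx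
  obtain ⟨U₀, hU₀, V₀, hV₀, hUV₀⟩ :=
    mem_nhds_prod_iff.mp (hc0.eventually (lt_mem_nhds (b := (Function.uncurry G₁ (x₀, 0))) hpos0))
  obtain ⟨U₁, hU₁, V₁, hV₁, hUV₁⟩ :=
    mem_nhds_prod_iff.mp (hcT.eventually (gt_mem_nhds (b := (Function.uncurry G₁ (x₀, T₀))) hneg))
  obtain ⟨δ₀, hδ₀, hB₀⟩ := Metric.mem_nhds_iff.mp hV₀
  obtain ⟨δ₁, hδ₁, hB₁⟩ := Metric.mem_nhds_iff.mp hV₁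
  -- A common width for both end windows: the signs of `G₁` hold on them, and `[δ, T₀ - δ]` stays
  -- inside `(0, T₀)`.
  set δ := min (min (δ₀ / 2) (δ₁ / 2)) (T₀ / 2) with hδ
  have hδpos : 0 < δ := by positivity
  have hδa : δ ≤ δ₀ / 2 := (min_le_left _ _).trans (min_le_left _ _)
  have hδb : δ ≤ δ₁ / 2 := (min_le_left _ _).trans (min_le_right _ _)
  have hmid : ∀ᶠ x in 𝓝 x₀, ∀ t ∈ Icc δ (T₀ - δ), 0 < G x t := by
    refine isCompact_Icc.eventually_forall_of_forall_eventually fun t ht => ?_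
    have hc := hcont t ⟨by linarith [ht.1], by linarith [ht.2]⟩
    exact hc.eventually (lt_mem_nhds (b := Function.uncurry G (x₀, t))
      (hpos t ⟨by linarith [ht.1], by linarith [ht.2]⟩))
  refine ⟨T, hTx₀, ⟨_, hTd⟩, ?_⟩
  filter_upwards [hG, h0, hzero, hmid, hU₀, hU₁, hTt.eventually (lt_mem_nhds hT₀),
    hTt.eventually (Ioo_mem_nhds (show T₀ - δ < T₀ by linarith) (show T₀ < T₀ + δ by linarith))]
    with x hGx h0x hzx hmx hx₀ hx₁ hTp hTw
  refine ⟨hTp, hzx, fun t ht => ?_⟩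
  have hcx : Continuous (G x) :=
    continuous_iff_continuousAt.mpr fun s => (hGx s).continuousAt
  rcases lt_or_ge t δ with h1 | h1
  · have hmono : StrictMonoOn (G x) (Icc 0 δ) := by
      refine strictMonoOn_of_deriv_pos (convex_Icc _ _) hcx.continuousOn fun s hs => ?_
      rw [interior_Icc] at hs
      rw [(hGx s).deriv]
      have hsV : s ∈ V₀ := hB₀ (by
        rw [Metric.mem_ball, Real.dist_eq, sub_zero, abs_of_pos hs.1]; linarith [hs.2])
      exact hUV₀ (mk_mem_prod hx₀ hsV)
    have := hmono ⟨le_rfl, hδpos.le⟩ ⟨ht.1.le, h1.le⟩ ht.1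
    rwa [h0x] at this
  · rcases le_or_gt t (T₀ - δ) with h2 | h2
    · exact hmx t ⟨h1, h2⟩
    · have hanti : StrictAntiOn (G x) (Icc (T₀ - δ) (T₀ + δ)) := by
        refine strictAntiOn_of_deriv_neg (convex_Icc _ _) hcx.continuousOn fun s hs => ?_
        rw [interior_Icc] at hs
        rw [(hGx s).deriv]
        have hsV : s ∈ V₁ := hB₁ (by
          rw [Metric.mem_ball, Real.dist_eq, abs_lt]
          constructor <;> linarith [hs.1, hs.2])
        exact hUV₁ (mk_mem_prod hx₁ hsV)
      have := hanti ⟨h2.le, by linarith [ht.2, hTw.2]⟩ ⟨hTw.1.le, hTw.2.le⟩ ht.2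
      rwa [hzx] at this

/-! ### The equation `u'' = k u`. -/

/-- `C`, `S` are the fundamental solutions of `u'' = k u`, that is `cos (ω t)`, `sin (ω t) / ω`
for `k = -ω²` and `cosh (Ω t)`, `sinh (Ω t) / Ω` for `k = Ω²`. -/
structure IsFundamentalPair (k : ℝ) (C S : ℝ → ℝ) : Prop where
  deriv_C : ∀ t, HasStrictDerivAt C (k * S t) t
  deriv_S : ∀ t, HasStrictDerivAt S (C t) t
  C_zero : C 0 = 1
  S_zero : S 0 = 0
  wronskian : ∀ t, C t ^ 2 - k * S t ^ 2 = 1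

theorem isFundamentalPair_cos {ω : ℝ} (hω : 0 < ω) :
    IsFundamentalPair (-ω ^ 2) (fun t => Real.cos (ω * t)) (fun t => Real.sin (ω * t) / ω) where
  deriv_C t := by
    have h := (Real.hasStrictDerivAt_cos (ω * t)).comp t ((hasStrictDerivAt_id t).const_mul ω)
    refine h.congr_deriv ?_
    field_simp
  deriv_S t := by
    have h := ((Real.hasStrictDerivAt_sin (ω * t)).comp t
      ((hasStrictDerivAt_id t).const_mul ω)).div_const ω
    refine h.congr_deriv ?_
    field_simp
  C_zero := by simp
  S_zero := by simp
  wronskian t := by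
    field_simp
    linarith [Real.sin_sq_add_cos_sq (ω * t)]

theorem isFundamentalPair_cosh {Ω : ℝ} (hΩ : 0 < Ω) :
    IsFundamentalPair (Ω ^ 2) (fun t => Real.cosh (Ω * t)) (fun t => Real.sinh (Ω * t) / Ω) where
  deriv_C t := by
    have h := (Real.hasStrictDerivAt_cosh (Ω * t)).comp t ((hasStrictDerivAt_id t).const_mul Ω)
    refine h.congr_deriv ?_
    field_simp
  deriv_S t := by
    have h := ((Real.hasStrictDerivAt_sinh (Ω * t)).comp t
      ((hasStrictDerivAt_id t).const_mul Ω)).div_const Ω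
    refine h.congr_deriv ?_
    field_simp
  C_zero := by simp
  S_zero := by simp
  wronskian t := by
    field_simp
    linarith [Real.cosh_sq (Ω * t)]

open Set in
/-- Uniqueness for `u'' = k u` on `[0, T]`. -/
theorem IsFundamentalPair.eq_of_ode {k : ℝ} {C S : ℝ → ℝ} (H : IsFundamentalPair k C S)
    {T : ℝ} {w w' : ℝ → ℂ} (h : ∀ t ∈ Icc 0 T, HasDerivWithinAt w (w' t) (Icc 0 T) t)
    (h' : ∀ t ∈ Icc 0 T, HasDerivWithinAt w' ((k : ℂ) * w t) (Icc 0 T) t) :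
    ∀ t ∈ Icc 0 T, w t = C t * w 0 + S t * w' 0 ∧
      w' t = (k * S t : ℝ) * w 0 + C t * w' 0 := by
  have hC : ∀ t, HasDerivWithinAt (fun t => (C t : ℂ)) ((k * S t : ℝ) : ℂ) (Icc 0 T) t := fun t =>
    (H.deriv_C t).hasDerivAt.ofReal_comp.hasDerivWithinAt
  have hS : ∀ t, HasDerivWithinAt (fun t => (S t : ℂ)) ((C t : ℝ) : ℂ) (Icc 0 T) t := fun t =>
    (H.deriv_S t).hasDerivAt.ofReal_comp.hasDerivWithinAt
  have const : ∀ f : ℝ → ℂ, (∀ t ∈ Icc 0 T, HasDerivWithinAt f 0 (Icc 0 T) t) →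
      ∀ t ∈ Icc 0 T, f t = f 0 := fun f hf => by
    refine constant_of_derivWithin_zero (fun t ht => (hf t ht).differentiableWithinAt) ?_
    intro t ht
    have ht' := Ico_subset_Icc_self ht
    exact (hf t ht').derivWithin (uniqueDiffOn_Icc (ht.1.trans_lt ht.2) t ht')
  intro t ht
  -- Applying the inverse of the fundamental matrix to `(w, w')` gives two constants of motion. The
  -- Wronskian identity then solves for `w` and `w'`.
  have hA := const (fun t => C t * w t - S t * w' t) (fun t ht => by
    refine (((hC t).mul (h t ht)).sub ((hS t).mul (h' t ht))).congr_deriv ?_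
    push_cast; ring) t ht
  have hB := const (fun t => C t * w' t - k * S t * w t) (fun t ht => by
    refine (((hC t).mul (h' t ht)).sub (((hS t).const_mul (k : ℂ)).mul (h t ht))).congr_deriv ?_
    push_cast; ring) t ht
  simp only [H.C_zero, H.S_zero, Complex.ofReal_one, Complex.ofReal_zero] at hA hB
  have hW : (C t : ℂ) ^ 2 - k * (S t : ℂ) ^ 2 = 1 := by exact_mod_cast H.wronskian t
  push_cast
  constructor
  · linear_combination (C t : ℂ) * hA + (S t : ℂ) * hB - w t * hW
  · linear_combination (k * S t : ℂ) * hA + (C t : ℂ) * hB - w' t * hW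

theorem IsFundamentalPair.hasDerivAt {k : ℝ} {C S : ℝ → ℝ} (H : IsFundamentalPair k C S)
    (p v : ℂ) (t : ℝ) :
    HasDerivAt (fun t => (C t : ℂ) * p + S t * v) ((k * S t : ℝ) * p + C t * v) t :=
  ((H.deriv_C t).hasDerivAt.ofReal_comp.mul_const p).add
    ((H.deriv_S t).hasDerivAt.ofReal_comp.mul_const v)

theorem IsFundamentalPair.hasDerivAt' {k : ℝ} {C S : ℝ → ℝ} (H : IsFundamentalPair k C S)
    (p v : ℂ) (t : ℝ) :
    HasDerivAt (fun t => ((k * S t : ℝ) : ℂ) * p + C t * v)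
      ((k : ℂ) * (C t * p + S t * v)) t := by
  refine ((((H.deriv_S t).hasDerivAt.const_mul k).ofReal_comp.mul_const p).add
    ((H.deriv_C t).hasDerivAt.ofReal_comp.mul_const v)).congr_deriv ?_
  push_cast; ring

/-- The conserved quantity `|u'|² - k |u|²` carries the zero-energy condition from the initial data
to the whole arc, for outer and inner arcs alike. -/
theorem IsFundamentalPair.energy {k : ℝ} {C S : ℝ → ℝ} (H : IsFundamentalPair k C S)
    (p v : ℂ) (t : ℝ) :
    ‖((k * S t : ℝ) : ℂ) * p + C t * v‖ ^ 2 - k * ‖(C t : ℂ) * p + S t * v‖ ^ 2 =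
      ‖v‖ ^ 2 - k * ‖p‖ ^ 2 := by
  simp only [← Complex.normSq_eq_norm_sq, Complex.normSq_apply, Complex.add_re, Complex.add_im,
    Complex.re_ofReal_mul, Complex.im_ofReal_mul]
  linear_combination (v.re * v.re + v.im * v.im - k * (p.re * p.re + p.im * p.im)) * H.wronskian t

/-! ### Ellipses with semiaxes `a` and `c` -/

/-- The ellipse `ξ ↦ (a cos ξ, c sin ξ)`. -/
noncomputable def axisEllipse (a c ξ : ℝ) : ℂ :=
  ((a * Real.cos ξ : ℝ) : ℂ) + ((c * Real.sin ξ : ℝ) : ℂ) * Complex.I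

/-- The quadratic form that defines the ellipse with semiaxes `a` and `c`. -/
noncomputable def axisForm (a c : ℝ) (z : ℂ) : ℝ := z.re ^ 2 / a ^ 2 + z.im ^ 2 / c ^ 2

/-- The open elliptic domain with semiaxes `a` and `c`. -/
def axisDomain (a c : ℝ) : Set ℂ := {z | axisForm a c z < 1}

/-- The speed of the parametrisation `axisEllipse a c`. -/
noncomputable def axisSpeed (a c ξ : ℝ) : ℝ :=
  Real.sqrt (a ^ 2 * Real.sin ξ ^ 2 + c ^ 2 * Real.cos ξ ^ 2)

@[simp] theorem axisEllipse_re (a c ξ : ℝ) : (axisEllipse a c ξ).re = a * Real.cos ξ := by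
  simp [axisEllipse, -Complex.ofReal_mul]

@[simp] theorem axisEllipse_im (a c ξ : ℝ) : (axisEllipse a c ξ).im = c * Real.sin ξ := by
  simp [axisEllipse, -Complex.ofReal_mul]

theorem axisEllipse_zero (a c : ℝ) : axisEllipse a c 0 = a := by
  simp [axisEllipse]

section
variable {a c : ℝ}

theorem axisForm_axisEllipse (ha : 0 < a) (hc : 0 < c) (ξ : ℝ) :
    axisForm a c (axisEllipse a c ξ) = 1 := by
  simp only [axisForm, axisEllipse_re, axisEllipse_im]
  field_simp
  linarith [Real.sin_sq_add_cos_sq ξ]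

theorem axisEllipse_inj (ha : 0 < a) (hc : 0 < c) {ξ η : ℝ} :
    axisEllipse a c ξ = axisEllipse a c η ↔
      Real.cos ξ = Real.cos η ∧ Real.sin ξ = Real.sin η := by
  rw [Complex.ext_iff]
  simp [ha.ne', hc.ne']

/-- The boundary parameter is defined only modulo `2π`; on the right half of the ellipse the arcsine
is a smooth choice of it, equal to `0` at the vertex `a`. -/
theorem axisEllipse_arcsin (ha : 0 < a) (hc : 0 < c) {z : ℂ} (hz : axisForm a c z = 1)
    (hre : 0 < z.re) : axisEllipse a c (Real.arcsin (z.im / c)) = z := by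
  have h1 : (z.re / a) ^ 2 + (z.im / c) ^ 2 = 1 := by
    rw [div_pow, div_pow]; exact hz
  have h2 : |z.im / c| ≤ 1 := abs_le_of_sq_le_sq (by nlinarith [sq_nonneg (z.re / a)]) zero_le_one
  rw [abs_le] at h2
  apply Complex.ext
  · rw [axisEllipse_re, Real.cos_arcsin, show 1 - (z.im / c) ^ 2 = (z.re / a) ^ 2 by linarith,
      Real.sqrt_sq (by positivity)]
    field_simp
  · rw [axisEllipse_im, Real.sin_arcsin h2.1 h2.2]
    field_simp

theorem axisSpeed_pos (ha : 0 < a) (hc : 0 < c) (ξ : ℝ) : 0 < axisSpeed a c ξ := by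
  apply Real.sqrt_pos.mpr
  rcases eq_or_ne (Real.sin ξ) 0 with h | h
  · have : Real.cos ξ ≠ 0 := fun h' => by
      have := Real.sin_sq_add_cos_sq ξ
      simp [h, h'] at this
    positivity
  · positivity

theorem axisSpeed_zero (hc : 0 < c) : axisSpeed a c 0 = c := by
  simp [axisSpeed, Real.sqrt_sq hc.le]

theorem hasDerivAt_axisEllipse (a c ξ : ℝ) :
    HasDerivAt (axisEllipse a c) (((-(a * Real.sin ξ) : ℝ) : ℂ) + ((c * Real.cos ξ : ℝ) : ℂ) * Complex.I) ξ := by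
  refine ((((Real.hasDerivAt_cos ξ).const_mul a).ofReal_comp).add
    ((((Real.hasDerivAt_sin ξ).const_mul c).ofReal_comp).mul_const Complex.I)).congr_deriv ?_
  push_cast; ring

theorem norm_deriv_axisEllipse (a c ξ : ℝ) : ‖deriv (axisEllipse a c) ξ‖ = axisSpeed a c ξ := by
  rw [(hasDerivAt_axisEllipse a c ξ).deriv, Complex.norm_add_mul_I, axisSpeed]
  congr 1
  ring

theorem unitTangent_re (a c ξ : ℝ) :
    (unitTangent (axisEllipse a c) ξ).re = -(a * Real.sin ξ) / axisSpeed a c ξ := by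
  rw [unitTangent, norm_deriv_axisEllipse, Complex.div_ofReal_re,
    (hasDerivAt_axisEllipse a c ξ).deriv]
  simp [-Complex.ofReal_mul, -Complex.ofReal_neg]

theorem unitTangent_im (a c ξ : ℝ) :
    (unitTangent (axisEllipse a c) ξ).im = c * Real.cos ξ / axisSpeed a c ξ := by
  rw [unitTangent, norm_deriv_axisEllipse, Complex.div_ofReal_im,
    (hasDerivAt_axisEllipse a c ξ).deriv]
  simp [-Complex.ofReal_mul, -Complex.ofReal_neg]

theorem unitNormal_re (a c ξ : ℝ) :
    (unitNormal (axisEllipse a c) ξ).re = c * Real.cos ξ / axisSpeed a c ξ := by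
  simp [unitNormal, unitTangent_im]

theorem unitNormal_im (a c ξ : ℝ) :
    (unitNormal (axisEllipse a c) ξ).im = a * Real.sin ξ / axisSpeed a c ξ := by
  simp [unitNormal, unitTangent_re, neg_div]

theorem normSq_unitTangent (ha : 0 < a) (hc : 0 < c) (ξ : ℝ) :
    (unitTangent (axisEllipse a c) ξ).re ^ 2 + (unitTangent (axisEllipse a c) ξ).im ^ 2 = 1 := by
  have h := axisSpeed_pos ha hc ξ
  have h2 : axisSpeed a c ξ ^ 2 = a ^ 2 * Real.sin ξ ^ 2 + c ^ 2 * Real.cos ξ ^ 2 :=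
    Real.sq_sqrt (by positivity)
  rw [unitTangent_re, unitTangent_im]
  field_simp
  linarith

theorem unitTangent_congr {ξ η : ℝ} (hcos : Real.cos ξ = Real.cos η)
    (hsin : Real.sin ξ = Real.sin η) :
    unitTangent (axisEllipse a c) ξ = unitTangent (axisEllipse a c) η := by
  have hN : axisSpeed a c ξ = axisSpeed a c η := by simp only [axisSpeed, hcos, hsin]
  apply Complex.ext <;> simp only [unitTangent_re, unitTangent_im, hcos, hsin, hN]

theorem continuous_axisForm (a c : ℝ) : Continuous (axisForm a c) := by
  unfold axisForm
  fun_prop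

theorem axisForm_real_mul (a c r : ℝ) (z : ℂ) : axisForm a c (r * z) = r ^ 2 * axisForm a c z := by
  simp only [axisForm, Complex.re_ofReal_mul, Complex.im_ofReal_mul]
  ring

theorem mem_closure_axisDomain (a c : ℝ) (z : ℂ) :
    z ∈ closure (axisDomain a c) ↔ axisForm a c z ≤ 1 := by
  constructor
  · intro h
    have : IsClosed {z | axisForm a c z ≤ 1} := isClosed_le (continuous_axisForm a c) continuous_const
    exact closure_minimal (fun z (hz : axisForm a c z < 1) => hz.le) this h
  · intro h
    -- Points with form at most `1` are limits of their contractions `r z`, `r < 1`, which lie in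
    -- the open domain.
    have hlim : Filter.Tendsto (fun r : ℝ => (r : ℂ) * z) (nhdsWithin 1 (Set.Iio 1)) (nhds z) := by
      have : Continuous fun r : ℝ => (r : ℂ) * z := by fun_prop
      have h2 := this.tendsto 1
      simp only [Complex.ofReal_one, one_mul] at h2
      exact h2.mono_left nhdsWithin_le_nhds
    refine mem_closure_of_tendsto hlim ?_
    filter_upwards [Ioo_mem_nhdsLT (show (0 : ℝ) < 1 by norm_num)] with r hr
    change axisForm a c (r * z) < 1
    rw [axisForm_real_mul]
    have h0 : 0 ≤ axisForm a c z := by unfold axisForm; positivity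
    nlinarith [hr.1, hr.2, mul_nonneg (sq_nonneg r) h0]

end

/-! ### First-order calculus at a real base point. -/

/-- `f` is strictly differentiable at the origin, with gradient `(l, m)`. -/
def HasGrad (f : ℝ × ℝ → ℝ) (l m : ℝ) : Prop :=
  HasStrictFDerivAt f (l • ContinuousLinearMap.fst ℝ ℝ ℝ + m • ContinuousLinearMap.snd ℝ ℝ ℝ) 0

/-- `f` is strictly differentiable at the origin, and its imaginary part has gradient `(l, m)`. -/
def HasImGrad (f : ℝ × ℝ → ℂ) (l m : ℝ) : Prop :=
  ∃ L : ℝ × ℝ →L[ℝ] ℂ, HasStrictFDerivAt f L 0 ∧ ∀ x, (L x).im = l * x.1 + m * x.2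

/-- `Z` is strictly differentiable at `(0, T)`, and the gradient of its imaginary part is
`(l, m)` in the space variable and vanishes in the time variable. -/
def HasImFlow (Z : ℝ × ℝ → ℝ → ℂ) (T l m : ℝ) : Prop :=
  ∃ L : (ℝ × ℝ) × ℝ →L[ℝ] ℂ, HasStrictFDerivAt (Function.uncurry Z) L (0, T) ∧
    ∀ x τ, (L (x, τ)).im = l * x.1 + m * x.2

theorem HasGrad.of_fderiv {f : ℝ × ℝ → ℝ} {L : ℝ × ℝ →L[ℝ] ℝ} {l m : ℝ}
    (h : HasStrictFDerivAt f L 0) (hL : ∀ x, L x = l * x.1 + m * x.2) : HasGrad f l m := by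
  have : L = l • ContinuousLinearMap.fst ℝ ℝ ℝ + m • ContinuousLinearMap.snd ℝ ℝ ℝ := by
    apply ContinuousLinearMap.ext
    intro x
    simp [hL]
  unfold HasGrad
  rwa [← this]

theorem hasGrad_fst : HasGrad Prod.fst 1 0 :=
  HasGrad.of_fderiv hasStrictFDerivAt_fst (by simp)

theorem hasGrad_snd : HasGrad Prod.snd 0 1 :=
  HasGrad.of_fderiv hasStrictFDerivAt_snd (by simp)

theorem HasGrad.add {f g : ℝ × ℝ → ℝ} {l m l' m' : ℝ} (hf : HasGrad f l m) (hg : HasGrad g l' m') :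
    HasGrad (fun x => f x + g x) (l + l') (m + m') :=
  HasGrad.of_fderiv (HasStrictFDerivAt.add hf hg) (fun x => by simp; ring)

theorem HasGrad.comp {f : ℝ × ℝ → ℝ} {l m : ℝ} (hf : HasGrad f l m) {g : ℝ → ℝ} {g' y : ℝ}
    (hg : HasStrictDerivAt g g' y) (h0 : f 0 = y) : HasGrad (fun x => g (f x)) (g' * l) (g' * m) := by
  subst h0
  exact HasGrad.of_fderiv (hg.comp_hasStrictFDerivAt (0 : ℝ × ℝ) hf) (fun x => by simp; ring)

theorem HasGrad.comp₂ {f f₁ f₂ : ℝ × ℝ → ℝ} {l m l₁ m₁ l₂ m₂ : ℝ} (hf : HasGrad f l m)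
    (h₁ : HasGrad f₁ l₁ m₁) (h₂ : HasGrad f₂ l₂ m₂) (h₁0 : f₁ 0 = 0) (h₂0 : f₂ 0 = 0) :
    HasGrad (fun x => f (f₁ x, f₂ x)) (l * l₁ + m * l₂) (l * m₁ + m * m₂) := by
  unfold HasGrad at h₁ h₂
  have h := h₁.prodMk h₂
  have h0 : (fun x => (f₁ x, f₂ x)) (0 : ℝ × ℝ) = 0 := by simp [h₁0, h₂0]
  have hf' : HasStrictFDerivAt f (l • ContinuousLinearMap.fst ℝ ℝ ℝ +
      m • ContinuousLinearMap.snd ℝ ℝ ℝ) ((fun x => (f₁ x, f₂ x)) (0 : ℝ × ℝ)) := by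
    rw [h0]; exact hf
  exact HasGrad.of_fderiv (hf'.comp (0 : ℝ × ℝ) h) (fun x => by simp; ring)

/-- The gradient of `K` is multiplied by `f 0 = 0`, so `K` need only be differentiable and its
derivative never has to be computed. -/
theorem HasGrad.mul_of_zero {f K : ℝ × ℝ → ℝ} {l m : ℝ} (hf : HasGrad f l m) (h0 : f 0 = 0)
    (hK : ContDiffAt ℝ 1 K 0) : HasGrad (fun x => K x * f x) (K 0 * l) (K 0 * m) :=
  HasGrad.of_fderiv ((hK.hasStrictFDerivAt (by simp)).mul hf) (fun x => by simp [h0]; ring)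

theorem HasGrad.congr {f : ℝ × ℝ → ℝ} {l m l' m' : ℝ} (hf : HasGrad f l m) (hl : l = l')
    (hm : m = m') : HasGrad f l' m' := hl ▸ hm ▸ hf

theorem HasImGrad.of_re_im {f : ℝ × ℝ → ℂ} {l m : ℝ} (hre : ContDiffAt ℝ 1 (fun x => (f x).re) 0)
    (him : HasGrad (fun x => (f x).im) l m) : HasImGrad f l m := by
  have h := (Complex.ofRealCLM.hasStrictFDerivAt.comp (0 : ℝ × ℝ)
    (hre.hasStrictFDerivAt (by simp))).add
    ((Complex.ofRealCLM.hasStrictFDerivAt.comp (0 : ℝ × ℝ) him).mul_const Complex.I)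
  refine ⟨_, h.congr_of_eventuallyEq (Filter.Eventually.of_forall fun x => ?_), fun x => by simp⟩
  simp [Complex.re_add_im]

theorem HasImGrad.im {f : ℝ × ℝ → ℂ} {l m : ℝ} (hf : HasImGrad f l m) :
    HasGrad (fun x => (f x).im) l m := by
  obtain ⟨L, hL, hL'⟩ := hf
  exact HasGrad.of_fderiv (Complex.imCLM.hasStrictFDerivAt.comp (0 : ℝ × ℝ) hL) (by simpa using hL')

/-- Since both base values are real, the product rule for imaginary parts involves no derivative of
a real part. -/
theorem HasImGrad.mul {f g : ℝ × ℝ → ℂ} {l m l' m' p q : ℝ} (hf : HasImGrad f l m)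
    (hg : HasImGrad g l' m') (hf0 : f 0 = p) (hg0 : g 0 = q) :
    HasImGrad (fun x => f x * g x) (p * l' + q * l) (p * m' + q * m) := by
  obtain ⟨L, hL, hL'⟩ := hf
  obtain ⟨M, hM, hM'⟩ := hg
  refine ⟨_, hL.mul hM, fun x => ?_⟩
  simp [hf0, hg0, hL', hM']
  ring

theorem HasImGrad.conj {f : ℝ × ℝ → ℂ} {l m : ℝ} (hf : HasImGrad f l m) :
    HasImGrad (fun x => (starRingEnd ℂ) (f x)) (-l) (-m) := by
  obtain ⟨L, hL, hL'⟩ := hf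
  refine ⟨_, (Complex.conjCLE.toContinuousLinearMap.hasStrictFDerivAt).comp (0 : ℝ × ℝ) hL,
    fun x => ?_⟩
  simp [hL']
  ring

theorem hasImGrad_ofReal {f : ℝ × ℝ → ℝ} (hf : ContDiffAt ℝ 1 f 0) :
    HasImGrad (fun x => (f x : ℂ)) 0 0 :=
  ⟨_, Complex.ofRealCLM.hasStrictFDerivAt.comp (0 : ℝ × ℝ) (hf.hasStrictFDerivAt (by simp)),
    fun x => by simp⟩

/-- The time derivative at the base point is the real number `f' * p`, which is why it is invisible
to the imaginary part. -/
theorem HasImGrad.flow {P : ℝ × ℝ → ℂ} {l m p : ℝ} (hP : HasImGrad P l m) (h0 : P 0 = p)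
    {f : ℝ → ℝ} {f' T : ℝ} (hf : HasStrictDerivAt f f' T) :
    HasImFlow (fun x t => (f t : ℂ) * P x) T (f T * l) (f T * m) := by
  obtain ⟨L, hL, hL'⟩ := hP
  have h1 := Complex.ofRealCLM.hasStrictFDerivAt.comp ((0 : ℝ × ℝ), T)
    (hf.comp_hasStrictFDerivAt ((0 : ℝ × ℝ), T) (hasStrictFDerivAt_snd (𝕜 := ℝ)))
  have h2 := HasStrictFDerivAt.comp ((0 : ℝ × ℝ), T) (g := P) hL (hasStrictFDerivAt_fst (𝕜 := ℝ))
  refine ⟨_, h1.mul h2, fun x τ => ?_⟩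
  simp [h0, hL']
  ring

theorem HasImFlow.add {f g : ℝ × ℝ → ℝ → ℂ} {T l m l' m' : ℝ} (hf : HasImFlow f T l m)
    (hg : HasImFlow g T l' m') : HasImFlow (fun x t => f x t + g x t) T (l + l') (m + m') := by
  obtain ⟨L, hL, hL'⟩ := hf
  obtain ⟨M, hM, hM'⟩ := hg
  exact ⟨_, hL.add hM, fun x τ => by simp [hL', hM']; ring⟩

/-- The variation of the norm is real and multiplies the real value `q`, so it contributes nothing
to the imaginary part. -/
theorem HasImFlow.div_norm {Z V : ℝ × ℝ → ℝ → ℂ} {T l m l' m' p q : ℝ} (hZ : HasImFlow Z T l m)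
    (hV : HasImFlow V T l' m') (hp : 0 < p) (hZ0 : Z 0 T = p) (hV0 : V 0 T = q) :
    HasImFlow (fun x t => V x t / ((2 * ‖Z x t‖ : ℝ) : ℂ)) T (l' / (2 * p)) (m' / (2 * p)) := by
  obtain ⟨L, hL, -⟩ := hZ
  obtain ⟨M, hM, hM'⟩ := hV
  have hne : Function.uncurry Z (0, T) ≠ 0 := by simp [Function.uncurry, hZ0, hp.ne']
  have hn : ContDiffAt ℝ 1 (fun z : ℂ => (2 * ‖z‖)⁻¹) (Function.uncurry Z (0, T)) :=
    (contDiffAt_const.mul (contDiffAt_norm ℝ hne)).inv (by simpa using hne)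
  have h1 := Complex.ofRealCLM.hasStrictFDerivAt.comp ((0 : ℝ × ℝ), T)
    ((hn.hasStrictFDerivAt (by simp)).comp ((0 : ℝ × ℝ), T) hL)
  refine ⟨_, (hM.mul h1).congr_of_eventuallyEq (Filter.Eventually.of_forall fun x => ?_),
    fun x τ => ?_⟩
  · simp [Function.uncurry, div_eq_mul_inv]
  · simp [Function.uncurry, hZ0, hV0, hM', abs_of_pos hp, -Complex.ofReal_inv,
      -Complex.ofReal_mul]
    field_simp

/-- This is where the derivative `T'` of the hitting time disappears: the imaginary part has no time
component. -/
theorem HasImFlow.comp {Z : ℝ × ℝ → ℝ → ℂ} {T₀ l m : ℝ} (hZ : HasImFlow Z T₀ l m)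
    {T : ℝ × ℝ → ℝ} {T' : ℝ × ℝ →L[ℝ] ℝ} (hT : HasStrictFDerivAt T T' 0) (hT0 : T 0 = T₀) :
    HasImGrad (fun x => Z x (T x)) l m := by
  obtain ⟨L, hL, hL'⟩ := hZ
  subst hT0
  refine ⟨_, hL.comp (0 : ℝ × ℝ) ((hasStrictFDerivAt_id (𝕜 := ℝ) (0 : ℝ × ℝ)).prodMk hT),
    fun x => ?_⟩
  simp [hL']

theorem real_inner_complex (z w : ℂ) : inner ℝ z w = z.re * w.re + z.im * w.im := by
  rw [Complex.inner]
  simp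
  ring

section
variable {a c : ℝ}

theorem contDiff_axisEllipse (a c : ℝ) : ContDiff ℝ 1 (axisEllipse a c) := by
  unfold axisEllipse
  exact (Complex.ofRealCLM.contDiff.comp (contDiff_const.mul Real.contDiff_cos)).add
    ((Complex.ofRealCLM.contDiff.comp (contDiff_const.mul Real.contDiff_sin)).mul contDiff_const)

theorem axisEllipse_ne_zero (ha : 0 < a) (hc : 0 < c) (ξ : ℝ) : axisEllipse a c ξ ≠ 0 := fun h => by
  have := axisForm_axisEllipse ha hc ξ
  simp [h, axisForm] at this

theorem contDiff_norm_axisEllipse (ha : 0 < a) (hc : 0 < c) :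
    ContDiff ℝ 1 (fun ξ => ‖axisEllipse a c ξ‖) :=
  (contDiff_axisEllipse a c).norm ℝ (axisEllipse_ne_zero ha hc)

theorem contDiff_axisSpeed (ha : 0 < a) (hc : 0 < c) : ContDiff ℝ 1 (axisSpeed a c) := by
  unfold axisSpeed
  refine ContDiff.sqrt ?_ (fun ξ => ?_)
  · have := Real.contDiff_sin (n := 1)
    have := Real.contDiff_cos (n := 1)
    fun_prop
  · exact (Real.sqrt_pos.mp (axisSpeed_pos ha hc ξ)).ne'

theorem contDiff_outerPotential (E ω : ℝ) (ha : 0 < a) (hc : 0 < c) :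
    ContDiff ℝ 1 (fun ξ => outerPotential E ω (axisEllipse a c ξ)) := by
  unfold outerPotential
  exact contDiff_const.sub (contDiff_const.mul ((contDiff_norm_axisEllipse ha hc).pow 2))

theorem contDiff_innerPotential (E h μ : ℝ) (ha : 0 < a) (hc : 0 < c) :
    ContDiff ℝ 1 (fun ξ => innerPotential E h μ (axisEllipse a c ξ)) := by
  unfold innerPotential
  exact contDiff_const.add (contDiff_const.div (contDiff_norm_axisEllipse ha hc)
    (fun ξ => by simpa using axisEllipse_ne_zero ha hc ξ))

theorem hasGrad_arcsin_im {Z : ℝ × ℝ → ℂ} {l m p c : ℝ} (hZ : HasImGrad Z l m) (hZ0 : Z 0 = (p : ℂ)) :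
    HasGrad (fun x => Real.arcsin ((Z x).im / c)) (l / c) (m / c) := by
  have h1 : HasStrictDerivAt (fun y : ℝ => y / c) (1 / c) 0 := (hasStrictDerivAt_id 0).div_const c
  have h2 : HasStrictDerivAt Real.arcsin 1 0 := by
    simpa using Real.hasStrictDerivAt_arcsin (x := 0) (by norm_num) (by norm_num)
  refine ((hZ.im.comp h1 (by simp [hZ0])).comp h2 (by simp [hZ0])).congr ?_ ?_ <;> ring

/-- The inner product is a quotient whose numerator `Re V * (-a sin e) + Im V * (c cos e)` vanishes
at the base point. Hence only the value `c |q|` of the denominator, speed times norm, matters. -/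
theorem hasGrad_inner_unitTangent (ha : 0 < a) (hc : 0 < c) {V : ℝ × ℝ → ℂ} {e : ℝ × ℝ → ℝ}
    {l m l' m' q : ℝ} (hV : HasImGrad V l m) (he : HasGrad e l' m') (hV0 : V 0 = (q : ℂ))
    (hq : q ≠ 0) (he0 : e 0 = 0) :
    HasGrad (fun x => inner ℝ (V x / (‖V x‖ : ℂ)) (unitTangent (axisEllipse a c) (e x)))
      ((l - q * a / c * l') / |q|) ((m - q * a / c * m') / |q|) := by
  have hVs : ∃ L, HasStrictFDerivAt V L 0 := ⟨hV.choose, hV.choose_spec.1⟩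
  obtain ⟨L, hL⟩ := hVs
  have hVne : V 0 ≠ 0 := by simpa [hV0] using hq
  have hK := (((contDiffAt_norm ℝ hVne).hasStrictFDerivAt (n := 1) (by simp)).comp (0 : ℝ × ℝ) hL)
  have hN := ((contDiff_axisSpeed ha hc).contDiffAt (x := e 0)).hasStrictFDerivAt (by simp) |>.comp
    (0 : ℝ × ℝ) he
  have hsin : HasGrad (fun x => -a * Real.sin (e x)) (-a * l') (-a * m') := by
    refine he.comp (g := fun y => -a * Real.sin y) (y := 0) (g' := -a) ?_ he0
    simpa using (Real.hasStrictDerivAt_sin 0).const_mul (-a)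
  have hcos := ((Real.hasStrictDerivAt_cos (e 0)).const_mul c).comp_hasStrictFDerivAt (0 : ℝ × ℝ) he
  have hre := Complex.reCLM.hasStrictFDerivAt.comp (0 : ℝ × ℝ) hL
  have hM : HasGrad (fun x => (V x).re * (-a * Real.sin (e x)) + (V x).im * (c * Real.cos (e x)))
      (q * (-a * l') + c * l) (q * (-a * m') + c * m) := by
    refine HasGrad.of_fderiv ((hre.mul hsin).add (HasStrictFDerivAt.mul hV.im hcos)) (fun x => ?_)
    simp [hV0, he0]
    ring
  have hD := (hN.mul hK)
  have hDne : axisSpeed a c (e 0) * ‖V 0‖ ≠ 0 :=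
    mul_ne_zero (axisSpeed_pos ha hc _).ne' (by simpa using hVne)
  have hDi := (hasStrictDerivAt_inv hDne).comp_hasStrictFDerivAt (0 : ℝ × ℝ) hD
  refine HasGrad.of_fderiv ((HasStrictFDerivAt.mul hM hDi).congr_of_eventuallyEq
    (Filter.Eventually.of_forall fun x => ?_)) (fun x => ?_)
  · simp only [real_inner_complex, Complex.div_ofReal_re, Complex.div_ofReal_im,
      unitTangent_re, unitTangent_im]
    simp
    ring
  · simp [hV0, he0, axisSpeed_zero hc]
    have := abs_pos.mpr hq
    field_simp
    ring

end

/-! ### Passage from the boundary to itself along a family of arcs. -/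

theorem contDiff_axisForm (a c : ℝ) : ContDiff ℝ 1 (axisForm a c) := by
  unfold axisForm
  have h1 : ContDiff ℝ 1 Complex.re := Complex.reCLM.contDiff
  have h2 : ContDiff ℝ 1 Complex.im := Complex.imCLM.contDiff
  exact ((h1.pow 2).div_const _).add ((h2.pow 2).div_const _)

theorem hasDerivAt_axisForm (a c : ℝ) {z : ℝ → ℂ} {z' : ℂ} {s : Set ℝ} {t : ℝ}
    (h : HasDerivWithinAt z z' s t) : HasDerivWithinAt (fun t => axisForm a c (z t))
      (2 * (z t).re * z'.re / a ^ 2 + 2 * (z t).im * z'.im / c ^ 2) s t := by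
  have h1 : HasDerivWithinAt (fun t => (z t).re) z'.re s t :=
    Complex.reCLM.hasFDerivAt.comp_hasDerivWithinAt t h
  have h2 : HasDerivWithinAt (fun t => (z t).im) z'.im s t :=
    Complex.imCLM.hasFDerivAt.comp_hasDerivWithinAt t h
  refine (((h1.pow 2).div_const (a ^ 2)).add ((h2.pow 2).div_const (c ^ 2))).congr_deriv ?_
  simp

open Filter Topology Set in
/-- The passage from the boundary ellipse to itself along a family of arcs `Z x` that lie, near a
reference arc between perpendicular crossings at the vertex `a`, on the side of the ellipse given
by the sign `ε`. The functions `e` and `σ` give the point of arrival and the tangential component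
of the direction `V` at the arrival. -/
theorem exists_transit {a c : ℝ} (ha : 0 < a) (hc : 0 < c) {Z Z₁ V : ℝ × ℝ → ℝ → ℂ}
    {T₀ ε l m l' m' q₀ q₁ q : ℝ} (hT₀ : 0 < T₀)
    (hZd : ∀ᶠ x in 𝓝 0, ∀ t, HasDerivAt (Z x) (Z₁ x t) t)
    (hZc : ∀ t, ContinuousAt (Function.uncurry Z) (0, t))
    (hZ₁c : ∀ t, ContinuousAt (Function.uncurry Z₁) (0, t))
    (hZ : HasImFlow Z T₀ l m) (hV : HasImFlow V T₀ l' m')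
    (hstart : ∀ᶠ x in 𝓝 0, axisForm a c (Z x 0) = 1)
    (hZ0 : Z 0 0 = (a : ℂ)) (hZ₁0 : Z₁ 0 0 = (q₀ : ℂ)) (hq₀ : 0 < ε * q₀)
    (hZT : Z 0 T₀ = (a : ℂ)) (hZ₁T : Z₁ 0 T₀ = (q₁ : ℂ)) (hq₁ : ε * q₁ < 0)
    (hbase : ∀ t ∈ Ioo 0 T₀, 0 < ε * (axisForm a c (Z 0 t) - 1))
    (hVT : V 0 T₀ = (q : ℂ)) (hq : q ≠ 0) :
    ∃ T e σ : ℝ × ℝ → ℝ, T 0 = T₀ ∧ e 0 = 0 ∧ σ 0 = 0 ∧ HasGrad e (l / c) (m / c) ∧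
      HasGrad σ ((l' - q * a / c * (l / c)) / |q|) ((m' - q * a / c * (m / c)) / |q|) ∧
      ∀ᶠ x in 𝓝 0, 0 < T x ∧ (∀ t ∈ Ioo 0 (T x), 0 < ε * (axisForm a c (Z x t) - 1)) ∧
        axisEllipse a c (e x) = Z x (T x) ∧
        σ x = inner ℝ (V x (T x) / (‖V x (T x)‖ : ℂ)) (unitTangent (axisEllipse a c) (e x)) := by
  obtain ⟨L, hL, -⟩ := id hZ
  have hε : ε ≠ 0 := by rintro rfl; simp at hq₀
  have hfa : axisForm a c (a : ℂ) = 1 := by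
    simp only [axisForm, Complex.ofReal_re, Complex.ofReal_im]
    field_simp
    simp
  -- `G` is positive on the side of the ellipse selected by `ε`, and `G₁` is its time derivative.
  -- Perpendicular crossings at the vertex reduce the transversality signs to those of `ε * q₀` and
  -- `ε * q₁`.
  set G : ℝ × ℝ → ℝ → ℝ := fun x t => ε * (axisForm a c (Z x t) - 1) with hG
  set G₁ : ℝ × ℝ → ℝ → ℝ := fun x t =>
    ε * (2 * (Z x t).re * (Z₁ x t).re / a ^ 2 + 2 * (Z x t).im * (Z₁ x t).im / c ^ 2) with hG₁
  have hG₁c : ∀ t, ContinuousAt (Function.uncurry G₁) (0, t) := fun t => by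
    have h1 := hZc t
    have h2 := hZ₁c t
    have e1 : Function.uncurry G₁ = fun p =>
        ε * (2 * (Function.uncurry Z p).re * (Function.uncurry Z₁ p).re / a ^ 2 +
          2 * (Function.uncurry Z p).im * (Function.uncurry Z₁ p).im / c ^ 2) := rfl
    rw [e1]
    have h1r := Complex.continuous_re.continuousAt.comp h1
    have h1i := Complex.continuous_im.continuousAt.comp h1
    have h2r := Complex.continuous_re.continuousAt.comp h2
    have h2i := Complex.continuous_im.continuousAt.comp h2
    exact continuousAt_const.mul ((((continuousAt_const.mul h1r).mul h2r).div_const _).add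
      (((continuousAt_const.mul h1i).mul h2i).div_const _))
  have hGc : ∀ t, ContinuousAt (Function.uncurry G) (0, t) := fun t =>
    continuousAt_const.mul (((continuous_axisForm a c).continuousAt.comp (hZc t)).sub
      continuousAt_const)
  have hGs := ((((contDiff_axisForm a c).contDiffAt.hasStrictFDerivAt (by simp)).comp
    ((0 : ℝ × ℝ), T₀) hL).sub_const 1).const_mul ε
  obtain ⟨T, hT0, ⟨T', hT'⟩, hTx⟩ := exists_first_hit (G := G) (G₁ := G₁) (x₀ := 0) hT₀
    (by
      filter_upwards [hZd] with x hx t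
      have := hasDerivAt_axisForm a c (hx t).hasDerivWithinAt (s := univ)
      rw [hasDerivWithinAt_univ] at this
      exact (this.sub_const 1).const_mul ε)
    (fun t _ => hGc t) (hG₁c 0) (hG₁c T₀) hGs
    (by
      filter_upwards [hstart] with x hx
      simp [hG, hx])
    (by
      simp only [hG₁, hZ0, hZ₁0, Complex.ofReal_re, Complex.ofReal_im]
      have : ε * (2 * a * q₀ / a ^ 2 + 2 * 0 * 0 / c ^ 2) = ε * q₀ * (2 / a) := by field_simp; ring
      rw [this]
      positivity)
    (by
      simp only [hG₁, hZT, hZ₁T, Complex.ofReal_re, Complex.ofReal_im]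
      have : ε * (2 * a * q₁ / a ^ 2 + 2 * 0 * 0 / c ^ 2) = ε * q₁ * (2 / a) := by field_simp; ring
      rw [this]
      exact mul_neg_of_neg_of_pos hq₁ (by positivity))
    (by simp [hG, hZT, hfa]) hbase
  have hZT' := hZ.comp hT' hT0
  have hVT' := hV.comp hT' hT0
  have hZ00 : (fun x => Z x (T x)) 0 = (a : ℂ) := by simp [hT0, hZT]
  have hV00 : (fun x => V x (T x)) 0 = (q : ℂ) := by simp [hT0, hVT]
  have he := hasGrad_arcsin_im (c := c) hZT' hZ00
  have he0 : (fun x => Real.arcsin ((Z x (T x)).im / c)) 0 = 0 := by simp [hT0, hZT]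
  have hσ := hasGrad_inner_unitTangent ha hc hVT' he hV00 hq he0
  refine ⟨T, _, _, hT0, he0, ?_, he, hσ, ?_⟩
  · simp only [hT0, hVT, hZT]
    simp [unitTangent_re]
  · have hcont : ContinuousAt (fun x => Z x (T x)) 0 := hZT'.choose_spec.1.continuousAt
    -- The point of arrival stays near the vertex `a`, in the half plane where the arcsine recovers
    -- the parameter.
    have hre : ∀ᶠ x in 𝓝 0, 0 < (Z x (T x)).re := by
      have h2 := (Complex.continuous_re.continuousAt.comp hcont)
      refine h2.eventually (lt_mem_nhds ?_)
      simpa [hT0, hZT] using ha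
    filter_upwards [hTx, hre] with x hx hxre
    refine ⟨hx.1, hx.2.2, axisEllipse_arcsin ha hc ?_ hxre, rfl⟩
    have := hx.2.1
    simp only [hG, mul_eq_zero, hε, false_or] at this
    linarith

/-! ### Outer arcs. -/

section Launch
variable {a c : ℝ}

theorem launchVel_re (E ω : ℝ) (x : ℝ × ℝ) : (launchVel E ω (axisEllipse a c) x).re =
    Real.sqrt (2 * outerPotential E ω (axisEllipse a c x.1)) / axisSpeed a c x.1 *
      (c * (Real.cos x.2 * Real.cos x.1) - a * (Real.sin x.2 * Real.sin x.1)) := by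
  simp only [launchVel, Complex.re_ofReal_mul, Complex.add_re, unitNormal_re, unitTangent_re]
  ring

theorem launchVel_im (E ω : ℝ) (x : ℝ × ℝ) : (launchVel E ω (axisEllipse a c) x).im =
    Real.sqrt (2 * outerPotential E ω (axisEllipse a c x.1)) / axisSpeed a c x.1 *
      (a * (Real.cos x.2 * Real.sin x.1) + c * (Real.sin x.2 * Real.cos x.1)) := by
  simp only [launchVel, Complex.im_ofReal_mul, Complex.add_im, unitNormal_im, unitTangent_im]
  ring

theorem hasImGrad_axisEllipse_fst (a c : ℝ) : HasImGrad (fun x => axisEllipse a c x.1) c 0 := by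
  refine HasImGrad.of_re_im ?_ ?_
  · have := (Complex.reCLM.contDiff.comp (contDiff_axisEllipse a c)).comp
      (contDiff_fst (𝕜 := ℝ) (E := ℝ) (F := ℝ) (n := 1))
    exact this.contDiffAt
  · simp only [axisEllipse_im]
    refine (hasGrad_fst.comp (g := fun y => c * Real.sin y) (g' := c) (y := 0) ?_ rfl).congr
      (by ring) (by ring)
    simpa using (Real.hasStrictDerivAt_sin 0).const_mul c

theorem contDiffAt_sqrt_div_axisSpeed (ha : 0 < a) (hc : 0 < c) {V : ℝ → ℝ} (hV : ContDiff ℝ 1 V)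
    (hV0 : 0 < V 0) :
    ContDiffAt ℝ 1 (fun x : ℝ × ℝ => Real.sqrt (2 * V x.1) / axisSpeed a c x.1) 0 := by
  have h1 : ContDiffAt ℝ 1 (fun ξ => Real.sqrt (2 * V ξ) / axisSpeed a c ξ) ((0 : ℝ × ℝ).1) :=
    ((contDiff_const.mul hV).contDiffAt.sqrt (mul_pos two_pos hV0).ne').div
      (contDiff_axisSpeed ha hc).contDiffAt (axisSpeed_pos ha hc _).ne'
  exact h1.comp (0 : ℝ × ℝ) contDiffAt_fst

theorem hasGrad_sin_cos (a c : ℝ) {f g : ℝ × ℝ → ℝ} {l m : ℝ} (hf : ContDiffAt ℝ 1 f 0)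
    (hg : HasGrad g l m) (hg0 : g 0 = 0) :
    HasGrad (fun x => a * (f x * Real.sin x.1) + c * (g x * Real.cos x.1))
      (a * f 0 + c * l) (c * m) := by
  have hs := hasGrad_fst.comp (Real.hasStrictDerivAt_sin 0) rfl
  have hcos : ContDiffAt ℝ 1 (fun x : ℝ × ℝ => Real.cos x.1) 0 :=
    (Real.contDiff_cos.comp contDiff_fst).contDiffAt
  have h := (hs.mul_of_zero (by simp) (contDiffAt_const (c := a).mul hf)).add
    (hg.mul_of_zero hg0 (contDiffAt_const (c := c).mul hcos))
  have e : (fun x : ℝ × ℝ => a * (f x * Real.sin x.1) + c * (g x * Real.cos x.1)) =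
      fun x => a * f x * Real.sin x.1 + c * Real.cos x.1 * g x := by
    funext x
    ring
  rw [e]
  exact h.congr (by simp) (by simp)

/-- At the vertex the normal turns at the rate `a / c` in `ξ`, so to first order the launch
direction has angle `(a / c) ξ + α`. -/
theorem hasImGrad_launchVel (ha : 0 < a) (hc : 0 < c) {E ω : ℝ}
    (hV : 0 < outerPotential E ω (a : ℂ)) :
    HasImGrad (launchVel E ω (axisEllipse a c))
      (Real.sqrt (2 * outerPotential E ω (a : ℂ)) * (a / c))
      (Real.sqrt (2 * outerPotential E ω (a : ℂ))) := by
  have hK := contDiffAt_sqrt_div_axisSpeed ha hc (contDiff_outerPotential E ω ha hc)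
    (by simpa [axisEllipse_zero] using hV)
  refine HasImGrad.of_re_im ?_ ?_
  · simp only [launchVel_re]
    refine hK.mul ?_
    have := Real.contDiff_sin (n := 1)
    have := Real.contDiff_cos (n := 1)
    fun_prop
  · simp only [launchVel_im]
    have hM := hasGrad_sin_cos a c (Real.contDiff_cos.comp contDiff_snd).contDiffAt
      (hasGrad_snd.comp (Real.hasStrictDerivAt_sin 0) rfl) (by simp)
    refine (hM.mul_of_zero (by simp) hK).congr ?_ ?_
    · simp only [Prod.fst_zero, axisEllipse_zero, axisSpeed_zero hc, Function.comp_apply,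
        Prod.snd_zero, Real.cos_zero]
      field_simp
      ring
    · simp only [Prod.fst_zero, axisEllipse_zero, axisSpeed_zero hc, Real.cos_zero]
      field_simp

end Launch

open Filter Topology Set in
/-- The transition along outer arcs near the arc perpendicular to the ellipse at the vertex `a`:
`e` is the parameter of the point of arrival and `σ` the tangential component of the direction
there. -/
theorem exists_outer_transition {E ω a c v : ℝ} (hE : 0 < E) (hω : 0 < ω) (ha : 0 < a) (hc : 0 < c)
    (hv0 : 0 < v) (hv : v ^ 2 / 2 = outerPotential E ω (a : ℂ)) :
    ∃ e σ : ℝ × ℝ → ℝ, ∃ e₁ e₂ : ℝ, e 0 = 0 ∧ σ 0 = 0 ∧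
      e₁ = (a ^ 2 * ω ^ 2 - v ^ 2) / (2 * E) + a ^ 2 * v ^ 2 / (E * c ^ 2) ∧
      e₂ = a * v ^ 2 / (E * c) ∧ HasGrad e e₁ e₂ ∧
      HasGrad σ (-(ω ^ 2 * a * c) / E + (a ^ 2 * ω ^ 2 - v ^ 2) / (2 * E) * (a / c) + a / c * e₁)
        ((a ^ 2 * ω ^ 2 - v ^ 2) / (2 * E) + a / c * e₂) ∧
      (∀ᶠ x in 𝓝 (0 : ℝ × ℝ),
        (∃ y y' T, IsOuterArc E ω (axisDomain a c) y y' T ∧ y 0 = axisEllipse a c x.1 ∧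
          y' 0 = launchVel E ω (axisEllipse a c) x ∧ y T = axisEllipse a c (e x) ∧
          inner ℝ (y' T / (‖y' T‖ : ℂ)) (unitTangent (axisEllipse a c) (e x)) = σ x) ∧
        ∀ y y' T ξ, IsOuterArc E ω (axisDomain a c) y y' T → y 0 = axisEllipse a c x.1 →
          y' 0 = launchVel E ω (axisEllipse a c) x → y T = axisEllipse a c ξ →
          y T = axisEllipse a c (e x) ∧
          inner ℝ (y' T / (‖y' T‖ : ℂ)) (unitTangent (axisEllipse a c) (e x)) = σ x) ∧
      ∃ y y' T, IsOuterArc E ω (axisDomain a c) y y' T ∧ y 0 = (a : ℂ) ∧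
        y' 0 = launchVel E ω (axisEllipse a c) 0 ∧ y T = (a : ℂ) ∧
        inner ℝ (y' T / (‖y' T‖ : ℂ)) (unitTangent (axisEllipse a c) 0) = 0 ∧
        ∀ s ∈ Icc 0 T, ∃ r : ℝ, 0 ≤ r ∧ y s = (r : ℂ) * a := by
  have hpot : v ^ 2 = 2 * E - ω ^ 2 * a ^ 2 := by
    simp only [outerPotential, Complex.norm_real, Real.norm_eq_abs, sq_abs] at hv
    linarith
  have hVpos : 0 < outerPotential E ω (a : ℂ) := by rw [← hv]; positivity
  have hsq : Real.sqrt (2 * outerPotential E ω (a : ℂ)) = v := by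
    rw [← hv, mul_div_cancel₀ _ two_ne_zero, Real.sqrt_sq hv0.le]
  have hF := isFundamentalPair_cos hω
  set C : ℝ → ℝ := fun t => Real.cos (ω * t) with hC
  set S : ℝ → ℝ := fun t => Real.sin (ω * t) / ω with hS
  set W := launchVel E ω (axisEllipse a c) with hW
  have hW' := hasImGrad_launchVel ha hc hVpos
  rw [hsq] at hW'
  have hγ' := hasImGrad_axisEllipse_fst a c
  have hγ0 : (fun x : ℝ × ℝ => axisEllipse a c x.1) 0 = (a : ℂ) := by simp [axisEllipse_zero]
  have hW0 : W 0 = (v : ℂ) := by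
    apply Complex.ext
    · rw [hW, launchVel_re]
      simp [axisEllipse_zero, axisSpeed_zero hc, hsq, hc.ne']
    · rw [hW, launchVel_im]
      simp
  have hWc : ContinuousAt W 0 := hW'.choose_spec.1.continuousAt
  have hγc : ContinuousAt (fun x : ℝ × ℝ => axisEllipse a c x.1) 0 :=
    hγ'.choose_spec.1.continuousAt
  -- The reference solution `a cos ωt + (v / ω) sin ωt` equals `a cos(ωt - φ) / cos φ`. It is
  -- symmetric about `ωt = φ`, hence returns to `a` at `T₀ = 2φ / ω`.
  set φ := Real.arctan (v / (a * ω)) with hφ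
  have hφ0 : 0 < φ := by rw [hφ, Real.arctan_pos]; positivity
  have hφ1 : φ < Real.pi / 2 := Real.arctan_lt_pi_div_two _
  have hcφ : 0 < Real.cos φ := Real.cos_arctan_pos _
  have hsφ : a * ω * Real.sin φ = v * Real.cos φ := by
    have := Real.tan_arctan (v / (a * ω))
    rw [← hφ, Real.tan_eq_sin_div_cos] at this
    field_simp at this
    linarith
  have hcsq : 2 * E * Real.cos φ ^ 2 = a ^ 2 * ω ^ 2 := by
    have h1 := Real.sin_sq_add_cos_sq φ
    have h2 : a ^ 2 * ω ^ 2 * Real.sin φ ^ 2 = v ^ 2 * Real.cos φ ^ 2 := by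
      rw [← mul_pow, ← mul_pow, ← mul_pow, hsφ]
    linear_combination a ^ 2 * ω ^ 2 * h1 - h2 - Real.cos φ ^ 2 * hpot
  set T₀ := 2 * φ / ω with hT₀
  have hT₀pos : 0 < T₀ := by positivity
  have hωT : ω * T₀ = 2 * φ := by rw [hT₀]; field_simp
  set Z : ℝ × ℝ → ℝ → ℂ := fun x t => C t * axisEllipse a c x.1 + S t * W x with hZ
  set V : ℝ × ℝ → ℝ → ℂ := fun x t =>
    ((-ω ^ 2 * S t : ℝ) : ℂ) * axisEllipse a c x.1 + C t * W x with hV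
  have hZbase : ∀ t, Z 0 t = ((a * (Real.cos (ω * t - φ) / Real.cos φ) : ℝ) : ℂ) := fun t => by
    have : a * (Real.cos (ω * t - φ) / Real.cos φ) = C t * a + S t * v := by
      rw [Real.cos_sub, hC, hS]
      field_simp
      linear_combination Real.sin (ω * t) * hsφ
    rw [this]
    simp [hZ, hW0, axisEllipse_zero]
  have hVbase : ∀ t, V 0 t = ((-ω ^ 2 * S t * a + C t * v : ℝ) : ℂ) := fun t => by
    simp [hV, hW0, axisEllipse_zero]
  -- The double angle formulas make `C` and `S` rational in the data at `T₀`, because the energy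
  -- relation gives `2E cos² φ = a²ω²`.
  have hCT : C T₀ = (a ^ 2 * ω ^ 2 - v ^ 2) / (2 * E) := by
    simp only [hC, hωT, Real.cos_two_mul]
    field_simp
    linear_combination 2 * hcsq + hpot
  have hST : S T₀ = a * v / E := by
    simp only [hS, hωT, Real.sin_two_mul]
    field_simp
    refine mul_left_cancel₀ (mul_pos ha hω).ne' ?_
    linear_combination 2 * Real.cos φ * E * hsφ + v * hcsq
  have hZT : Z 0 T₀ = (a : ℂ) := by
    rw [hZbase, hωT, two_mul, add_sub_cancel_right, div_self hcφ.ne', mul_one]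
  have hVT : V 0 T₀ = ((-v : ℝ) : ℂ) := by
    rw [hVbase, hCT, hST]
    congr 1
    field_simp
    linear_combination -hpot
  have hcont : ∀ {f g : ℝ → ℝ}, Continuous f → Continuous g → ∀ t, ContinuousAt (Function.uncurry
      fun (x : ℝ × ℝ) t => (f t : ℂ) * axisEllipse a c x.1 + g t * W x) (0, t) := by
    intro f g hf hg t
    have h1 : ContinuousAt (fun p : (ℝ × ℝ) × ℝ => axisEllipse a c p.1.1) (0, t) :=
      ContinuousAt.comp (x := ((0 : ℝ × ℝ), t)) (g := fun x : ℝ × ℝ => axisEllipse a c x.1)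
        hγc continuousAt_fst
    have h2 : ContinuousAt (fun p : (ℝ × ℝ) × ℝ => W p.1) (0, t) :=
      ContinuousAt.comp (x := ((0 : ℝ × ℝ), t)) (g := W) hWc continuousAt_fst
    have h3 : Continuous fun p : (ℝ × ℝ) × ℝ => (f p.2 : ℂ) :=
      Complex.continuous_ofReal.comp (hf.comp continuous_snd)
    have h4 : Continuous fun p : (ℝ × ℝ) × ℝ => (g p.2 : ℂ) :=
      Complex.continuous_ofReal.comp (hg.comp continuous_snd)
    exact (h3.continuousAt.mul h1).add (h4.continuousAt.mul h2)
  have hCc : Continuous C := by rw [hC]; fun_prop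
  have hSc : Continuous S := by rw [hS]; fun_prop
  have hZf := (hγ'.flow hγ0 (hF.deriv_C T₀)).add (hW'.flow hW0 (hF.deriv_S T₀))
  have hVf := (hγ'.flow hγ0 ((hF.deriv_S T₀).const_mul (-ω ^ 2))).add
    (hW'.flow hW0 (hF.deriv_C T₀))
  have hbase : ∀ t ∈ Ioo 0 T₀, 0 < 1 * (axisForm a c (Z 0 t) - 1) := fun t ht => by
    have h1 : 0 < ω * t := mul_pos hω ht.1
    have h2 : ω * t < 2 * φ := by rw [← hωT]; exact mul_lt_mul_of_pos_left ht.2 hω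
    -- For `0 < t < T₀` one has `|ωt - φ| < φ < π / 2`, so the reference arc stays beyond the
    -- vertex.
    have h3 : Real.cos φ < Real.cos (ω * t - φ) := by
      rw [← Real.cos_abs (ω * t - φ)]
      refine Real.cos_lt_cos_of_nonneg_of_le_pi (abs_nonneg _) (by linarith) ?_
      rw [abs_lt]
      constructor <;> linarith
    have h4 : 1 < Real.cos (ω * t - φ) / Real.cos φ := (one_lt_div hcφ).mpr h3
    have h5 : axisForm a c (Z 0 t) = (Real.cos (ω * t - φ) / Real.cos φ) ^ 2 := by
      rw [hZbase, axisForm, Complex.ofReal_re, Complex.ofReal_im]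
      field_simp
      ring
    rw [h5]
    nlinarith
  have hZd : ∀ x t, HasDerivAt (Z x) (V x t) t := fun x t => hF.hasDerivAt _ _ t
  have hZ00 : Z 0 0 = (a : ℂ) := by simp [hZ, hF.C_zero, hF.S_zero, axisEllipse_zero]
  have hV00 : V 0 0 = (v : ℂ) := by simp [hV, hF.C_zero, hF.S_zero, hW0]
  obtain ⟨T, e, σ, hT0, he0, hσ0, heG, hσG, hev⟩ := exists_transit ha hc (Z := Z) (Z₁ := V)
    (V := V) (ε := 1) (q₀ := v) (q₁ := -v) (q := -v) hT₀pos (Eventually.of_forall hZd)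
    (hcont hCc hSc) (hcont (continuous_const.mul hSc) hCc) hZf hVf
    (Eventually.of_forall fun x => by simp [hZ, hF.C_zero, hF.S_zero, axisForm_axisEllipse ha hc])
    hZ00 hV00 (by simpa using hv0) hZT hVT (by simpa using hv0) hbase hVT (neg_ne_zero.mpr hv0.ne')
  rw [abs_neg, abs_of_pos hv0] at hσG
  have hpos : ∀ᶠ x : ℝ × ℝ in 𝓝 0, 0 < outerPotential E ω (axisEllipse a c x.1) := by
    have h1 := ((contDiff_outerPotential E ω ha hc).continuous.comp
      (continuous_fst (X := ℝ) (Y := ℝ))).continuousAt (x := 0)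
    exact h1.eventually (lt_mem_nhds (by simpa [axisEllipse_zero] using hVpos))
  have harc : ∀ x : ℝ × ℝ, 0 < outerPotential E ω (axisEllipse a c x.1) → 0 < T x →
      (∀ t ∈ Ioo 0 (T x), 0 < 1 * (axisForm a c (Z x t) - 1)) →
      IsOuterArc E ω (axisDomain a c) (Z x) (V x) (T x) := by
    intro x hx hTx hpx
    refine ⟨hTx, fun s _ => (hZd x s).hasDerivWithinAt, fun s _ => ?_, fun s _ => ?_, ?_⟩
    · refine (hF.hasDerivAt' (axisEllipse a c x.1) (W x) s).hasDerivWithinAt.congr_deriv ?_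
      simp [hZ]
    · have h1 := hF.energy (axisEllipse a c x.1) (W x) s
      have h2 : ‖W x‖ ^ 2 = 2 * outerPotential E ω (axisEllipse a c x.1) := by
        have hN := axisSpeed_pos ha hc x.1
        have hN2 : axisSpeed a c x.1 ^ 2 = a ^ 2 * Real.sin x.1 ^ 2 + c ^ 2 * Real.cos x.1 ^ 2 :=
          Real.sq_sqrt (by positivity)
        have hs := Real.sq_sqrt (mul_pos two_pos hx).le
        have h5 := Real.sin_sq_add_cos_sq x.2
        rw [← Complex.normSq_eq_norm_sq, Complex.normSq_apply, hW, launchVel_re, launchVel_im]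
        field_simp
        rw [hs, hN2]
        linear_combination (2 * outerPotential E ω (axisEllipse a c x.1)) *
          (a ^ 2 * Real.sin x.1 ^ 2 + c ^ 2 * Real.cos x.1 ^ 2) * h5
      change ‖V x s‖ ^ 2 - -ω ^ 2 * ‖Z x s‖ ^ 2 = _ at h1
      rw [h2] at h1
      simp only [outerPotential] at h1 ⊢
      linarith
    · intro s hs h
      rw [mem_closure_axisDomain] at h
      linarith [hpx s hs]
  refine ⟨e, σ, _, _, he0, hσ0, rfl, rfl, heG.congr ?_ ?_, hσG.congr ?_ ?_, ?_, ?_⟩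
  · rw [hCT, hST]; field_simp
  · rw [hCT, hST]; field_simp; ring
  · rw [hCT, hST]; field_simp; ring
  · rw [hCT, hST]; field_simp; ring
  · filter_upwards [hev, hpos] with x hx hVx
    obtain ⟨hTx, hpx, hex, hσx⟩ := hx
    refine ⟨⟨Z x, V x, T x, harc x hVx hTx hpx, ?_, ?_, hex.symm, hσx.symm⟩, ?_⟩
    · simp [hZ, hF.C_zero, hF.S_zero]
    · simp [hV, hF.C_zero, hF.S_zero]
    intro y y' T₁ ξ hy hy0 hy'0 hyT
    have hsol := hF.eq_of_ode hy.deriv_pos (fun t ht => by simpa using hy.deriv_vel t ht)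
    have hyZ : ∀ t ∈ Icc 0 T₁, y t = Z x t ∧ y' t = V x t := fun t ht => by
      have := hsol t ht
      rw [hy0, hy'0] at this
      exact this
    -- An arc that ends on the boundary cannot end before `T x`, where it is still strictly outside.
    -- It cannot last longer either, since at `T x` it would touch the closed domain.
    have hTT : T₁ = T x := by
      have hT₁ : T₁ ∈ Icc 0 T₁ := ⟨hy.pos.le, le_rfl⟩
      rcases lt_trichotomy T₁ (T x) with h | h | h
      · have h1 := hpx T₁ ⟨hy.pos, h⟩
        rw [← (hyZ T₁ hT₁).1, hyT, axisForm_axisEllipse ha hc] at h1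
        simp at h1
      · exact h
      · refine absurd ?_ (hy.outside (T x) ⟨hTx, h⟩)
        rw [mem_closure_axisDomain, (hyZ (T x) ⟨hTx.le, h.le⟩).1, ← hex,
          axisForm_axisEllipse ha hc]
    subst hTT
    have := hyZ (T x) ⟨hTx.le, le_rfl⟩
    rw [this.1, this.2]
    exact ⟨hex.symm, hσx.symm⟩
  · obtain ⟨hTx, hpx, hex, hσx⟩ := hev.self_of_nhds
    refine ⟨Z 0, V 0, T 0, harc 0 hpos.self_of_nhds hTx hpx, hZ00, by rw [hV00, hW0], ?_, ?_, ?_⟩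
    · rw [hT0, hZT]
    · rw [he0, hσ0] at hσx
      exact hσx.symm
    · intro s hs
      refine ⟨Real.cos (ω * s - φ) / Real.cos φ, ?_, ?_⟩
      · have h1 : 0 ≤ ω * s := mul_nonneg hω.le hs.1
        have h2 : ω * s ≤ 2 * φ := by
          rw [← hωT, ← hT0]; exact mul_le_mul_of_nonneg_left hs.2 hω.le
        exact div_nonneg (Real.cos_nonneg_of_mem_Icc ⟨by linarith, by linarith⟩) hcφ.le
      · rw [hZbase]; push_cast; ring

/-! ### Inner arcs. -/

section InnerLaunch
variable {a c : ℝ}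

/-- The zero energy velocity of an inner arc that leaves `axisEllipse a c x.1` inwards, with
direction of tangential component `x.2`. -/
noncomputable def inwardVel (E h μ a c : ℝ) (x : ℝ × ℝ) : ℂ :=
  (Real.sqrt (2 * innerPotential E h μ (axisEllipse a c x.1)) : ℂ) *
    (((-Real.sqrt (1 - x.2 ^ 2) : ℝ) : ℂ) * unitNormal (axisEllipse a c) x.1 +
      (x.2 : ℂ) * unitTangent (axisEllipse a c) x.1)

theorem inwardVel_re (E h μ : ℝ) (x : ℝ × ℝ) : (inwardVel E h μ a c x).re =
    Real.sqrt (2 * innerPotential E h μ (axisEllipse a c x.1)) / axisSpeed a c x.1 *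
      (c * (-Real.sqrt (1 - x.2 ^ 2) * Real.cos x.1) - a * (x.2 * Real.sin x.1)) := by
  simp only [inwardVel, Complex.re_ofReal_mul, Complex.add_re, unitNormal_re, unitTangent_re]
  ring

theorem inwardVel_im (E h μ : ℝ) (x : ℝ × ℝ) : (inwardVel E h μ a c x).im =
    Real.sqrt (2 * innerPotential E h μ (axisEllipse a c x.1)) / axisSpeed a c x.1 *
      (a * (-Real.sqrt (1 - x.2 ^ 2) * Real.sin x.1) + c * (x.2 * Real.cos x.1)) := by
  simp only [inwardVel, Complex.im_ofReal_mul, Complex.add_im, unitNormal_im, unitTangent_im]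
  ring

theorem hasImGrad_inwardVel (ha : 0 < a) (hc : 0 < c) {E h μ : ℝ}
    (hV : 0 < innerPotential E h μ (a : ℂ)) :
    HasImGrad (inwardVel E h μ a c)
      (-Real.sqrt (2 * innerPotential E h μ (a : ℂ)) * (a / c))
      (Real.sqrt (2 * innerPotential E h μ (a : ℂ))) := by
  have hK := contDiffAt_sqrt_div_axisSpeed ha hc (contDiff_innerPotential E h μ ha hc)
    (by simpa [axisEllipse_zero] using hV)
  have hS : ContDiffAt ℝ 1 (fun x : ℝ × ℝ => -Real.sqrt (1 - x.2 ^ 2)) 0 := by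
    refine (ContDiffAt.sqrt ?_ (by simp)).neg
    exact contDiffAt_const.sub (contDiffAt_snd.pow 2)
  refine HasImGrad.of_re_im ?_ ?_
  · simp only [inwardVel_re]
    have h1 : ContDiffAt ℝ 1 (fun x : ℝ × ℝ => Real.cos x.1) 0 :=
      (Real.contDiff_cos.comp contDiff_fst).contDiffAt
    have h2 : ContDiffAt ℝ 1 (fun x : ℝ × ℝ => Real.sin x.1) 0 :=
      (Real.contDiff_sin.comp contDiff_fst).contDiffAt
    exact hK.mul ((contDiffAt_const.mul (hS.mul h1)).sub
      (contDiffAt_const.mul (contDiffAt_snd.mul h2)))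
  · simp only [inwardVel_im]
    have hM := hasGrad_sin_cos a c hS hasGrad_snd (by simp)
    refine (hM.mul_of_zero (by simp) hK).congr ?_ ?_
    · simp only [Prod.fst_zero, axisEllipse_zero, axisSpeed_zero hc, Prod.snd_zero]
      simp
      field_simp
    · simp only [Prod.fst_zero, axisEllipse_zero, axisSpeed_zero hc]
      field_simp

theorem unitNormal_eq (a c ξ : ℝ) : (unitNormal (axisEllipse a c) ξ).re =
    (unitTangent (axisEllipse a c) ξ).im ∧ (unitNormal (axisEllipse a c) ξ).im =
    -(unitTangent (axisEllipse a c) ξ).re := by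
  simp [unitNormal]

theorem norm_inwardVel (ha : 0 < a) (hc : 0 < c) {E h μ : ℝ} {x : ℝ × ℝ} (hx : x.2 ^ 2 ≤ 1) :
    ‖inwardVel E h μ a c x‖ = Real.sqrt (2 * innerPotential E h μ (axisEllipse a c x.1)) := by
  rw [inwardVel, norm_mul, Complex.norm_real, Real.norm_eq_abs, abs_of_nonneg (Real.sqrt_nonneg _)]
  have ht := normSq_unitTangent ha hc x.1
  obtain ⟨h1, h2⟩ := unitNormal_eq a c x.1
  have : ‖((-Real.sqrt (1 - x.2 ^ 2) : ℝ) : ℂ) * unitNormal (axisEllipse a c) x.1 +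
      (x.2 : ℂ) * unitTangent (axisEllipse a c) x.1‖ ^ 2 = 1 := by
    rw [← Complex.normSq_eq_norm_sq, Complex.normSq_apply]
    simp only [Complex.add_re, Complex.add_im, Complex.re_ofReal_mul, Complex.im_ofReal_mul, h1, h2]
    have hs := Real.sq_sqrt (show 0 ≤ 1 - x.2 ^ 2 by linarith)
    linear_combination (1 - x.2 ^ 2 + x.2 ^ 2) * ht +
      ((unitTangent (axisEllipse a c) x.1).re ^ 2 + (unitTangent (axisEllipse a c) x.1).im ^ 2) * hs
  rw [(pow_eq_one_iff_of_nonneg (norm_nonneg _) two_ne_zero).mp this, mul_one]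

theorem inner_inwardVel (ha : 0 < a) (hc : 0 < c) {E h μ : ℝ} {x : ℝ × ℝ} (hx : x.2 ^ 2 ≤ 1)
    (hV : 0 < innerPotential E h μ (axisEllipse a c x.1)) :
    inner ℝ (inwardVel E h μ a c x / (‖inwardVel E h μ a c x‖ : ℂ))
      (unitTangent (axisEllipse a c) x.1) = x.2 := by
  have hu : 0 < Real.sqrt (2 * innerPotential E h μ (axisEllipse a c x.1)) :=
    Real.sqrt_pos.mpr (by linarith)
  rw [norm_inwardVel ha hc hx, inwardVel, mul_div_cancel_left₀ _ (by exact_mod_cast hu.ne'),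
    real_inner_complex]
  obtain ⟨h1, h2⟩ := unitNormal_eq a c x.1
  simp only [Complex.add_re, Complex.add_im, Complex.re_ofReal_mul, Complex.im_ofReal_mul, h1, h2]
  linear_combination x.2 * normSq_unitTangent ha hc x.1

end InnerLaunch

/-- The square of a Levi-Civita solution, in terms of the physical initial data. -/
theorem leviCivita_sq (C S : ℝ) (w v : ℂ) :
    (C * w + S * (v * (starRingEnd ℂ) w)) ^ 2 = ((C ^ 2 : ℝ) : ℂ) * w ^ 2 +
      ((2 * C * S : ℝ) : ℂ) * (‖w ^ 2‖ * v) +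
      ((S ^ 2 : ℝ) : ℂ) * (v * v * (starRingEnd ℂ) (w ^ 2)) := by
  have h := Complex.mul_conj' w
  rw [norm_pow, map_pow]
  push_cast
  rw [← h]
  ring

/-- The physical velocity of a Levi-Civita solution, in terms of the physical initial data. -/
theorem leviCivita_vel (k C S : ℝ) (w v : ℂ) :
    (((k * S : ℝ) : ℂ) * w + C * (v * (starRingEnd ℂ) w)) /
        (starRingEnd ℂ) (C * w + S * (v * (starRingEnd ℂ) w)) =
      (((2 * k * C * S : ℝ) : ℂ) * w ^ 2 + ((2 * (C ^ 2 + k * S ^ 2) : ℝ) : ℂ) * (‖w ^ 2‖ * v) +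
        ((2 * C * S : ℝ) : ℂ) * (v * v * (starRingEnd ℂ) (w ^ 2))) /
        ((2 * ‖(C * w + S * (v * (starRingEnd ℂ) w)) ^ 2‖ : ℝ) : ℂ) := by
  set W := C * w + S * (v * (starRingEnd ℂ) w) with hW
  have h := Complex.mul_conj' w
  have e : (((2 * k * C * S : ℝ) : ℂ) * w ^ 2 + ((2 * (C ^ 2 + k * S ^ 2) : ℝ) : ℂ) * (‖w ^ 2‖ * v) +
        ((2 * C * S : ℝ) : ℂ) * (v * v * (starRingEnd ℂ) (w ^ 2))) =
        2 * W * (((k * S : ℝ) : ℂ) * w + C * (v * (starRingEnd ℂ) w)) := by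
    rw [norm_pow, map_pow, hW]
    push_cast
    rw [← h]
    ring
  rw [e, norm_pow]
  -- At a collision both sides are quotients by zero and take the value `0`.
  rcases eq_or_ne W 0 with h0 | h0
  · simp [h0]
  · have hc : (starRingEnd ℂ) W ≠ 0 := by simpa using h0
    push_cast
    rw [← Complex.mul_conj' W]
    field_simp

open Filter Topology Set in
/-- An inner arc leaves the ellipse inwards. -/
theorem RefractionGalaxy.IsInnerArc.innerVel_zero {E h μ a c : ℝ} (ha : 0 < a) (hc : 0 < c) {w w' : ℝ → ℂ} {T : ℝ}
    (H : IsInnerArc E h μ (axisDomain a c) w w' T) {x : ℝ × ℝ}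
    (hV : 0 < innerPotential E h μ (axisEllipse a c x.1))
    (h0 : innerPos w 0 = axisEllipse a c x.1)
    (hs : inner ℝ (innerVel w w' 0 / (‖innerVel w w' 0‖ : ℂ))
      (unitTangent (axisEllipse a c) x.1) = x.2) :
    innerVel w w' 0 = inwardVel E h μ a c x := by
  have hγ := axisEllipse_ne_zero ha hc x.1
  have hw0 : w 0 ≠ 0 := by
    intro hw
    rw [← h0] at hγ
    simp [innerPos, hw] at hγ
  obtain ⟨hk1, -, hk3⟩ := H.kepler ⟨le_rfl, H.pos.le⟩ hw0
  set v := innerVel w w' 0 with hv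
  rw [h0] at hk1 hk3
  have hnv : ‖v‖ = Real.sqrt (2 * innerPotential E h μ (axisEllipse a c x.1)) := by
    rw [← Real.sqrt_sq (norm_nonneg v)]
    congr 1
    linarith
  have hvpos : 0 < ‖v‖ := by rw [hnv]; exact Real.sqrt_pos.mpr (by linarith)
  set t := unitTangent (axisEllipse a c) x.1 with ht
  obtain ⟨hn1, hn2⟩ := unitNormal_eq a c x.1
  rw [← ht] at hn1 hn2
  have htt : t.re ^ 2 + t.im ^ 2 = 1 := normSq_unitTangent ha hc x.1
  set d := v / (‖v‖ : ℂ) with hd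
  have hdv : v = ‖v‖ * d := by
    rw [hd, mul_div_cancel₀ _ (by exact_mod_cast hvpos.ne')]
  have hdd : d.re ^ 2 + d.im ^ 2 = 1 := by
    have : ‖d‖ ^ 2 = 1 := by rw [hd, norm_div]; simp [hvpos.ne']
    rw [← Complex.normSq_eq_norm_sq, Complex.normSq_apply] at this
    linarith
  rw [real_inner_complex] at hs
  -- `n` is the outward normal component of the unit direction `d`. The tangential component
  -- determines it up to sign.
  set n := d.re * t.im - d.im * t.re with hn
  have hns : n ^ 2 = 1 - x.2 ^ 2 := by
    rw [← hs, hn]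
    linear_combination (t.re ^ 2 + t.im ^ 2) * hdd + htt
  have hN := axisSpeed_pos ha hc x.1
  have hNt : t.re = -(a * Real.sin x.1) / axisSpeed a c x.1 := unitTangent_re a c x.1
  have hNt' : t.im = c * Real.cos x.1 / axisSpeed a c x.1 := unitTangent_im a c x.1
  have hd0 : d.re = n * t.im + x.2 * t.re := by
    rw [hn, ← hs]; linear_combination -d.re * htt
  have hd1 : d.im = -n * t.re + x.2 * t.im := by
    rw [hn, ← hs]; linear_combination -d.im * htt
  -- The defining form is `1` at the start and below `1` afterwards, so its one-sided derivative is
  -- nonpositive; this derivative is a positive multiple of `n`.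
  have hle : n ≤ 0 := by
    have hder := hasDerivAt_axisForm a c hk1
    have hder' := hder.mono Ioo_subset_Icc_self
    rw [hasDerivWithinAt_iff_tendsto_slope' (by simp)] at hder'
    have := left_nhdsWithin_Ioo_neBot H.pos
    have hslope := le_of_tendsto (b := 0) hder' (by
      filter_upwards [self_mem_nhdsWithin] with τ hτ
      have h1 : axisForm a c (innerPos w τ) < 1 := H.inside τ hτ
      rw [slope_def_field, h0, axisForm_axisEllipse ha hc]
      exact div_nonpos_of_nonpos_of_nonneg (by linarith) (by linarith [hτ.1]))
    have e : 2 * (innerPos w 0).re * (((2 * ‖axisEllipse a c x.1‖ : ℝ) : ℂ) * v).re / a ^ 2 +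
        2 * (innerPos w 0).im * (((2 * ‖axisEllipse a c x.1‖ : ℝ) : ℂ) * v).im / c ^ 2 =
        4 * ‖axisEllipse a c x.1‖ * ‖v‖ * axisSpeed a c x.1 / (a * c) * n := by
      have hN2 : axisSpeed a c x.1 ^ 2 = a ^ 2 * Real.sin x.1 ^ 2 + c ^ 2 * Real.cos x.1 ^ 2 :=
        Real.sq_sqrt (by positivity)
      rw [h0, Complex.re_ofReal_mul, Complex.im_ofReal_mul]
      nth_rw 1 [hdv]
      nth_rw 2 [hdv]
      rw [Complex.re_ofReal_mul, Complex.im_ofReal_mul, hd0, hd1, hNt, hNt', axisEllipse_re,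
        axisEllipse_im]
      field_simp
      linear_combination (-4 * n) * hN2
    rw [e] at hslope
    by_contra hcon
    push Not at hcon
    have : 0 < 4 * ‖axisEllipse a c x.1‖ * ‖v‖ * axisSpeed a c x.1 / (a * c) * n := by positivity
    linarith
  have hsq : -Real.sqrt (1 - x.2 ^ 2) = n := by
    rw [← hns, Real.sqrt_sq_eq_abs, abs_of_nonpos hle, neg_neg]
  rw [inwardVel, ← hnv, hsq, ← ht]
  nth_rw 1 [hdv]
  congr 1
  apply Complex.ext
  · simp only [Complex.add_re, Complex.re_ofReal_mul, hn1]
    linarith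
  · simp only [Complex.add_im, Complex.im_ofReal_mul, hn2]
    linarith

/-- Levi-Civita solutions with zero energy initial data are inner arcs. -/
theorem IsFundamentalPair.isInnerArc {E h μ : ℝ} {C S : ℝ → ℝ}
    (hF : IsFundamentalPair (2 * (E + h)) C S) {D : Set ℂ} {w v : ℂ} {T : ℝ} (hw : w ≠ 0)
    (hv : ‖v‖ ^ 2 = 2 * innerPotential E h μ (w ^ 2)) (hT : 0 < T)
    (hD : ∀ t ∈ Set.Ioo 0 T, (C t * w + S t * (v * (starRingEnd ℂ) w)) ^ 2 ∈ D) :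
    IsInnerArc E h μ D (fun t => C t * w + S t * (v * (starRingEnd ℂ) w))
      (fun t => ((2 * (E + h) * S t : ℝ) : ℂ) * w + C t * (v * (starRingEnd ℂ) w)) T where
  pos := hT
  deriv_pos t _ := (hF.hasDerivAt w (v * (starRingEnd ℂ) w) t).hasDerivWithinAt
  deriv_vel t _ := (hF.hasDerivAt' w (v * (starRingEnd ℂ) w) t).hasDerivWithinAt
  energy t _ := by
    have h1 := hF.energy w (v * (starRingEnd ℂ) w) t
    have h2 : ‖v * (starRingEnd ℂ) w‖ ^ 2 - 2 * (E + h) * ‖w‖ ^ 2 = 2 * μ := by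
      have h3 : 0 < ‖w‖ := norm_pos_iff.mpr hw
      rw [norm_mul, RCLike.norm_conj, mul_pow, hv, innerPotential, norm_pow]
      field_simp
      ring
    rw [h2] at h1
    linarith
  inside := hD

set_option maxHeartbeats 1000000 in
open Filter Topology Set in
/-- The transition along inner arcs near the collision arc perpendicular to the ellipse at the
vertex `a`, in terms of the boundary parameter and the tangential component of the direction. -/
theorem exists_inner_transition {E h μ a c u : ℝ} (hEh : 0 < E + h) (hμ : 0 < μ) (ha : 0 < a)
    (hc : 0 < c) (hu0 : 0 < u) (hu : u ^ 2 / 2 = innerPotential E h μ (a : ℂ)) :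
    ∃ e σ : ℝ × ℝ → ℝ, ∃ C₀ S₀ e₁ e₂ : ℝ, e 0 = 0 ∧ σ 0 = 0 ∧
      C₀ = (2 * (E + h) * a + μ) / μ ∧ S₀ = u * a / μ ∧
      e₁ = C₀ ^ 2 - 2 * C₀ * S₀ * (a ^ 2 * u / c ^ 2) +
        S₀ ^ 2 * (2 * a ^ 2 * u ^ 2 / c ^ 2 - u ^ 2) ∧
      e₂ = (2 * C₀ * S₀ * (a * u) - S₀ ^ 2 * (2 * u ^ 2 * a)) / c ∧ HasGrad e e₁ e₂ ∧
      HasGrad σ ((2 * (2 * (E + h)) * C₀ * S₀ * c -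
            2 * (C₀ ^ 2 + 2 * (E + h) * S₀ ^ 2) * (a ^ 2 * u / c) +
            2 * C₀ * S₀ * (2 * a ^ 2 * u ^ 2 / c - u ^ 2 * c)) / (2 * a * u) - a / c * e₁)
        ((2 * (C₀ ^ 2 + 2 * (E + h) * S₀ ^ 2) * (a * u) - 2 * C₀ * S₀ * (2 * u ^ 2 * a)) /
          (2 * a * u) - a / c * e₂) ∧
      (∀ᶠ x in 𝓝 (0 : ℝ × ℝ),
        (∃ w w' T, IsInnerArc E h μ (axisDomain a c) w w' T ∧ innerPos w 0 = axisEllipse a c x.1 ∧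
          inner ℝ (innerVel w w' 0 / (‖innerVel w w' 0‖ : ℂ)) (unitTangent (axisEllipse a c) x.1) =
            x.2 ∧ innerPos w T = axisEllipse a c (e x) ∧
          inner ℝ (innerVel w w' T / (‖innerVel w w' T‖ : ℂ)) (unitTangent (axisEllipse a c) (e x)) =
            σ x) ∧
        ∀ w w' T ξ, IsInnerArc E h μ (axisDomain a c) w w' T → innerPos w 0 = axisEllipse a c x.1 →
          inner ℝ (innerVel w w' 0 / (‖innerVel w w' 0‖ : ℂ)) (unitTangent (axisEllipse a c) x.1) =
            x.2 → innerPos w T = axisEllipse a c ξ → innerPos w T = axisEllipse a c (e x) ∧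
          inner ℝ (innerVel w w' T / (‖innerVel w w' T‖ : ℂ)) (unitTangent (axisEllipse a c) (e x)) =
            σ x) ∧
      ∃ w w' T, IsInnerArc E h μ (axisDomain a c) w w' T ∧ innerPos w 0 = (a : ℂ) ∧
        inner ℝ (innerVel w w' 0 / (‖innerVel w w' 0‖ : ℂ)) (unitTangent (axisEllipse a c) 0) = 0 ∧
        innerPos w T = (a : ℂ) ∧
        inner ℝ (innerVel w w' T / (‖innerVel w w' T‖ : ℂ)) (unitTangent (axisEllipse a c) 0) = 0 ∧
        ∀ s ∈ Icc 0 T, ∃ r : ℝ, 0 ≤ r ∧ innerPos w s = (r : ℂ) * a := by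
  obtain ⟨Ω, hΩ0, hΩ⟩ : ∃ Ω : ℝ, 0 < Ω ∧ Ω ^ 2 = 2 * (E + h) :=
    ⟨Real.sqrt (2 * (E + h)), Real.sqrt_pos.mpr (by linarith), Real.sq_sqrt (by linarith)⟩
  have hpot : u ^ 2 = Ω ^ 2 + 2 * μ / a := by
    simp only [innerPotential, Complex.norm_real, Real.norm_eq_abs, abs_of_pos ha] at hu
    rw [hΩ]
    linear_combination 2 * hu
  have hpot' : a * u ^ 2 = a * Ω ^ 2 + 2 * μ := by rw [hpot]; field_simp
  rw [← hΩ]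
  have hVpos : 0 < innerPotential E h μ (a : ℂ) := by rw [← hu]; positivity
  have hsq : Real.sqrt (2 * innerPotential E h μ (a : ℂ)) = u := by
    rw [← hu, mul_div_cancel₀ _ two_ne_zero, Real.sqrt_sq hu0.le]
  have hF := isFundamentalPair_cosh hΩ0
  set C : ℝ → ℝ := fun t => Real.cosh (Ω * t) with hC
  set S : ℝ → ℝ := fun t => Real.sinh (Ω * t) / Ω with hS
  set U := inwardVel E h μ a c with hU
  have hU' := hasImGrad_inwardVel ha hc hVpos
  rw [hsq] at hU'
  have hγ' := hasImGrad_axisEllipse_fst a c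
  have hγ0 : (fun x : ℝ × ℝ => axisEllipse a c x.1) 0 = (a : ℂ) := by simp [axisEllipse_zero]
  have hU0 : U 0 = ((-u : ℝ) : ℂ) := by
    apply Complex.ext
    · rw [hU, inwardVel_re]
      simp [axisEllipse_zero, axisSpeed_zero hc, hsq, hc.ne']
    · rw [hU, inwardVel_im]
      simp
  set Q : ℝ × ℝ → ℂ := fun x => (‖axisEllipse a c x.1‖ : ℂ) * U x with hQ
  set R : ℝ × ℝ → ℂ := fun x => U x * U x * (starRingEnd ℂ) (axisEllipse a c x.1) with hR
  have hnorm : ContDiffAt ℝ 1 (fun x : ℝ × ℝ => ‖axisEllipse a c x.1‖) 0 :=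
    ((contDiff_norm_axisEllipse ha hc).comp contDiff_fst).contDiffAt
  have hQ' := (hasImGrad_ofReal hnorm).mul hU' (p := a) (q := -u)
    (by simp [axisEllipse_zero, abs_of_pos ha]) hU0
  have hR' := (hU'.mul hU' hU0 hU0).mul hγ'.conj (p := u * u) (q := a)
    (by simp only [← hU, hU0]; push_cast; ring) (by simp [axisEllipse_zero])
  have hQ0 : Q 0 = ((-(a * u) : ℝ) : ℂ) := by
    simp [hQ, hU0, axisEllipse_zero, abs_of_pos ha]
  have hR0 : R 0 = ((u ^ 2 * a : ℝ) : ℂ) := by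
    simp only [hR, hU0, Prod.fst_zero, axisEllipse_zero, Complex.conj_ofReal]
    push_cast; ring
  -- The reference solution in the Levi-Civita variable is `√a (C - u S)`, which runs from `√a` to
  -- `-√a`. Solving `C - u S = -1` together with `C² - Ω² S² = 1` gives `S = 2u / (u² - Ω²) = u a /
  -- μ`.
  set T₀ := Real.arsinh (Ω * (u * a / μ)) / Ω with hT₀
  have hT₀pos : 0 < T₀ := div_pos (Real.arsinh_pos_iff.mpr (by positivity)) hΩ0
  have hΩT : Ω * T₀ = Real.arsinh (Ω * (u * a / μ)) := by rw [hT₀]; field_simp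
  have hST : S T₀ = u * a / μ := by
    simp only [hS, hΩT, Real.sinh_arsinh]
    field_simp
  have hCT : C T₀ = (Ω ^ 2 * a + μ) / μ := by
    have h1 := hF.wronskian T₀
    rw [hST] at h1
    have h2 : 0 < C T₀ := Real.cosh_pos _
    refine (pow_left_inj₀ h2.le (by positivity) two_ne_zero).mp ?_
    have h3 : C T₀ ^ 2 = 1 + Ω ^ 2 * (u * a / μ) ^ 2 := by linarith
    rw [h3]
    field_simp
    linear_combination Ω ^ 2 * a * hpot'
  -- Position in Levi-Civita time, written through the physical initial data only. `Z₁` is its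
  -- derivative in that time, and dividing by `2 |Z|` gives the physical velocity `V`.
  set Z : ℝ × ℝ → ℝ → ℂ := fun x t => ((C t ^ 2 : ℝ) : ℂ) * axisEllipse a c x.1 +
    ((2 * C t * S t : ℝ) : ℂ) * Q x + ((S t ^ 2 : ℝ) : ℂ) * R x with hZ
  set Z₁ : ℝ × ℝ → ℝ → ℂ := fun x t => ((2 * Ω ^ 2 * C t * S t : ℝ) : ℂ) * axisEllipse a c x.1 +
    ((2 * (C t ^ 2 + Ω ^ 2 * S t ^ 2) : ℝ) : ℂ) * Q x + ((2 * C t * S t : ℝ) : ℂ) * R x with hZ₁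
  set V : ℝ × ℝ → ℝ → ℂ := fun x t => Z₁ x t / ((2 * ‖Z x t‖ : ℝ) : ℂ) with hV
  have dCC : ∀ t, HasStrictDerivAt (fun t => C t ^ 2) (2 * Ω ^ 2 * C t * S t) t := fun t =>
    ((hF.deriv_C t).pow 2).congr_deriv (by simp; ring)
  have dCS : ∀ t, HasStrictDerivAt (fun t => 2 * C t * S t) (2 * (C t ^ 2 + Ω ^ 2 * S t ^ 2)) t :=
    fun t => (((hF.deriv_C t).const_mul 2).mul (hF.deriv_S t)).congr_deriv (by ring)
  have dSS : ∀ t, HasStrictDerivAt (fun t => S t ^ 2) (2 * C t * S t) t := fun t =>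
    ((hF.deriv_S t).pow 2).congr_deriv (by simp; ring)
  have dCS' : ∀ t, HasStrictDerivAt (fun t => 2 * Ω ^ 2 * C t * S t)
      (2 * Ω ^ 2 * (C t ^ 2 + Ω ^ 2 * S t ^ 2)) t :=
    fun t => (((hF.deriv_C t).const_mul (2 * Ω ^ 2)).mul (hF.deriv_S t)).congr_deriv (by ring)
  have dQ' : ∀ t, HasStrictDerivAt (fun t => 2 * (C t ^ 2 + Ω ^ 2 * S t ^ 2))
      (2 * (2 * Ω ^ 2 * C t * S t + Ω ^ 2 * (2 * C t * S t))) t := fun t =>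
    ((dCC t).add ((dSS t).const_mul (Ω ^ 2))).const_mul 2
  have hZbase : ∀ t, Z 0 t = (((C t - u * S t) ^ 2 * a : ℝ) : ℂ) := fun t => by
    simp only [hZ, hQ0, hR0, Prod.fst_zero, axisEllipse_zero]
    push_cast
    ring
  have hZ₁base : ∀ t, Z₁ 0 t =
      ((2 * a * (C t - u * S t) * (Ω ^ 2 * S t - u * C t) : ℝ) : ℂ) := fun t => by
    simp only [hZ₁, hQ0, hR0, Prod.fst_zero, axisEllipse_zero]
    push_cast
    ring
  have hρT : C T₀ - u * S T₀ = -1 := by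
    rw [hCT, hST]
    field_simp
    linear_combination -hpot'
  have hρT' : Ω ^ 2 * S T₀ - u * C T₀ = -u := by
    rw [hCT, hST]
    field_simp
    ring
  have hZT : Z 0 T₀ = (a : ℂ) := by rw [hZbase, hρT]; simp
  have hZ₁T : Z₁ 0 T₀ = ((2 * a * u : ℝ) : ℂ) := by
    rw [hZ₁base, hρT, hρT']
    congr 1
    ring
  have hVT : V 0 T₀ = (u : ℂ) := by
    simp only [hV, hZ₁T, hZT, Complex.norm_real, Real.norm_eq_abs, abs_of_pos ha]
    have : (a : ℂ) ≠ 0 := by exact_mod_cast ha.ne'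
    push_cast
    field_simp
  have hγc : ContinuousAt (fun x : ℝ × ℝ => axisEllipse a c x.1) 0 :=
    hγ'.choose_spec.1.continuousAt
  have hQc : ContinuousAt Q 0 := hQ'.choose_spec.1.continuousAt
  have hRc : ContinuousAt R 0 := hR'.choose_spec.1.continuousAt
  have hcont : ∀ {f₁ f₂ f₃ : ℝ → ℝ}, Continuous f₁ → Continuous f₂ → Continuous f₃ →
      ∀ t, ContinuousAt (Function.uncurry fun (x : ℝ × ℝ) t =>
        (f₁ t : ℂ) * axisEllipse a c x.1 + f₂ t * Q x + f₃ t * R x) (0, t) := by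
    intro f₁ f₂ f₃ h₁ h₂ h₃ t
    have aux : ∀ {f : ℝ → ℝ} {P : ℝ × ℝ → ℂ}, Continuous f → ContinuousAt P 0 →
        ContinuousAt (fun p : (ℝ × ℝ) × ℝ => (f p.2 : ℂ) * P p.1) (0, t) := by
      intro f P hf hP
      have h3 : Continuous fun p : (ℝ × ℝ) × ℝ => (f p.2 : ℂ) :=
        Complex.continuous_ofReal.comp (hf.comp continuous_snd)
      exact h3.continuousAt.mul
        (ContinuousAt.comp (x := ((0 : ℝ × ℝ), t)) (g := P) hP continuousAt_fst)
    exact ((aux h₁ hγc).add (aux h₂ hQc)).add (aux h₃ hRc)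
  have cont : ∀ {f f' : ℝ → ℝ}, (∀ t, HasStrictDerivAt f (f' t) t) → Continuous f := fun hf =>
    continuous_iff_continuousAt.mpr fun t => (hf t).hasDerivAt.continuousAt
  have hZf := ((hγ'.flow hγ0 (dCC T₀)).add (hQ'.flow hQ0 (dCS T₀))).add (hR'.flow hR0 (dSS T₀))
  have hZ₁f := ((hγ'.flow hγ0 (dCS' T₀)).add (hQ'.flow hQ0 (dQ' T₀))).add (hR'.flow hR0 (dCS T₀))
  have hVf := hZf.div_norm hZ₁f ha hZT hZ₁T
  have hZd : ∀ x t, HasDerivAt (Z x) (Z₁ x t) t := fun x t =>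
    (((dCC t).hasDerivAt.ofReal_comp.mul_const _).add
      ((dCS t).hasDerivAt.ofReal_comp.mul_const _)).add
      ((dSS t).hasDerivAt.ofReal_comp.mul_const _)
  have hZx0 : ∀ x, Z x 0 = axisEllipse a c x.1 := fun x => by simp [hZ, hF.C_zero, hF.S_zero]
  -- Monotone descent from `1` to `-1` keeps `(C - u S)²` below `1` in between, through the
  -- collision. It rests on `Ω < u`, that is, on `μ > 0`.
  have hanti : StrictAnti fun t => C t - u * S t := by
    refine strictAnti_of_hasDerivAt_neg (f' := fun t => Ω ^ 2 * S t - u * C t)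
      (fun t => (hF.deriv_C t).hasDerivAt.sub ((hF.deriv_S t).hasDerivAt.const_mul u)) fun t => ?_
    have h1 : Ω < u := lt_of_pow_lt_pow_left₀ 2 hu0.le (by rw [hpot]; linarith [div_pos (mul_pos two_pos hμ) ha])
    have h2 := Real.sinh_lt_cosh (Ω * t)
    have h3 := Real.cosh_pos (Ω * t)
    have h4 : Ω ^ 2 * S t - u * C t = Ω * Real.sinh (Ω * t) - u * Real.cosh (Ω * t) := by
      simp only [hS, hC]
      field_simp
    simp only [h4]
    nlinarith
  have hbase : ∀ t ∈ Ioo 0 T₀, 0 < (-1 : ℝ) * (axisForm a c (Z 0 t) - 1) := fun t ht => by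
    have h1 := hanti ht.1
    have h2 := hanti ht.2
    simp only [hF.C_zero, hF.S_zero, hρT] at h1 h2
    have h5 : axisForm a c (Z 0 t) = ((C t - u * S t) ^ 2) ^ 2 := by
      rw [hZbase, axisForm, Complex.ofReal_re, Complex.ofReal_im]
      field_simp
      ring
    have h6 : (C t - u * S t) ^ 2 < 1 := by nlinarith
    rw [h5]
    nlinarith [sq_nonneg (C t - u * S t)]
  obtain ⟨T, e, σ, hT0, he0, hσ0, heG, hσG, hev⟩ := exists_transit ha hc (Z := Z) (Z₁ := Z₁)
    (V := V) (ε := -1) (q₀ := -(2 * a * u)) (q₁ := 2 * a * u) (q := u) hT₀pos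
    (Eventually.of_forall hZd)
    (hcont (cont dCC) (cont dCS) (cont dSS)) (hcont (cont dCS') (cont dQ') (cont dCS)) hZf hVf
    (Eventually.of_forall fun x => by rw [hZx0, axisForm_axisEllipse ha hc])
    (by rw [hZx0]; exact hγ0) (by rw [hZ₁base, hF.C_zero, hF.S_zero]; congr 1; ring)
    (by have := mul_pos ha hu0; linarith)
    hZT hZ₁T (by have := mul_pos ha hu0; linarith) hbase hVT hu0.ne'
  rw [abs_of_pos hu0] at hσG
  have hpos : ∀ᶠ x : ℝ × ℝ in 𝓝 0, 0 < innerPotential E h μ (axisEllipse a c x.1) := by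
    have h1 := ((contDiff_innerPotential E h μ ha hc).continuous.comp
      (continuous_fst (X := ℝ) (Y := ℝ))).continuousAt (x := 0)
    exact h1.eventually (lt_mem_nhds (by simpa [axisEllipse_zero] using hVpos))
  have hsmall : ∀ᶠ x : ℝ × ℝ in 𝓝 0, x.2 ^ 2 ≤ 1 := by
    have h1 : Continuous fun x : ℝ × ℝ => x.2 ^ 2 := by fun_prop
    exact (h1.continuousAt.eventually (gt_mem_nhds (by simp))).mono fun x hx => le_of_lt hx
  -- Either square root of the starting point may be used: position and physical velocity do not
  -- depend on it.
  have hgood : ∀ (x : ℝ × ℝ) (w₀ : ℂ), w₀ ^ 2 = axisEllipse a c x.1 → ∀ t,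
      (C t * w₀ + S t * (U x * (starRingEnd ℂ) w₀)) ^ 2 = Z x t ∧
      (((Ω ^ 2 * S t : ℝ) : ℂ) * w₀ + C t * (U x * (starRingEnd ℂ) w₀)) /
        (starRingEnd ℂ) (C t * w₀ + S t * (U x * (starRingEnd ℂ) w₀)) = V x t := by
    intro x w₀ hw t
    have h1 := leviCivita_sq (C t) (S t) w₀ (U x)
    have h2 := leviCivita_vel (Ω ^ 2) (C t) (S t) w₀ (U x)
    rw [hw] at h1 h2
    rw [h1] at h2
    exact ⟨h1, h2⟩
  have hex : ∀ x : ℝ × ℝ, 0 < innerPotential E h μ (axisEllipse a c x.1) → x.2 ^ 2 ≤ 1 → 0 < T x →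
      (∀ t ∈ Ioo 0 (T x), 0 < (-1 : ℝ) * (axisForm a c (Z x t) - 1)) →
      ∃ w w', IsInnerArc E h μ (axisDomain a c) w w' (T x) ∧
        ∀ t, innerPos w t = Z x t ∧ innerVel w w' t = V x t := by
    intro x hVx hx hTx hpx
    obtain ⟨w₀, hw₀⟩ := IsAlgClosed.exists_pow_nat_eq (axisEllipse a c x.1) two_pos
    have hg := hgood x w₀ hw₀
    have h2 : ‖U x‖ ^ 2 = 2 * innerPotential E h μ (w₀ ^ 2) := by
      rw [hU, norm_inwardVel ha hc hx, Real.sq_sqrt (by linarith), hw₀]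
    have hw0 : w₀ ≠ 0 := by
      rintro rfl
      exact axisEllipse_ne_zero ha hc x.1 (by rw [← hw₀]; simp)
    rw [hΩ] at hF
    refine ⟨_, _, hF.isInnerArc hw0 h2 hTx fun t ht => ?_, fun t => ?_⟩
    · rw [(hg t).1]
      have := hpx t ht
      change axisForm a c (Z x t) < 1
      linarith
    · rw [← hΩ]
      exact hg t
  refine ⟨e, σ, _, _, _, _, he0, hσ0, rfl, rfl, rfl, rfl, heG.congr ?_ ?_, hσG.congr ?_ ?_, ?_, ?_⟩
  · rw [hCT, hST]; field_simp; ring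
  · rw [hCT, hST]; field_simp; ring
  · rw [hCT, hST]; field_simp; ring
  · rw [hCT, hST]; field_simp; ring
  · filter_upwards [hev, hpos, hsmall] with x hx hVx hx1
    obtain ⟨hTx, hpx, hex', hσx⟩ := hx
    have hV0 : V x 0 = U x := by
      obtain ⟨w₀, hw₀⟩ := IsAlgClosed.exists_pow_nat_eq (axisEllipse a c x.1) two_pos
      have hw : (starRingEnd ℂ) w₀ ≠ 0 := by
        intro h
        have : w₀ = 0 := by simpa using h
        exact axisEllipse_ne_zero ha hc x.1 (by rw [← hw₀, this]; simp)
      have := (hgood x w₀ hw₀ 0).2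
      rw [← this]
      simp [hF.C_zero, hF.S_zero, hw]
    constructor
    · obtain ⟨w, w', harc, hw⟩ := hex x hVx hx1 hTx hpx
      refine ⟨w, w', T x, harc, ?_, ?_, ?_, ?_⟩
      · rw [(hw 0).1, hZx0]
      · rw [(hw 0).2, hV0]
        exact inner_inwardVel ha hc hx1 hVx
      · rw [(hw _).1, hex']
      · rw [(hw _).2, hσx]
    · intro w w' T₁ ξ H hw0 hs hwT
      have hvel := H.innerVel_zero ha hc hVx hw0 hs
      have hw0' : w 0 ^ 2 = axisEllipse a c x.1 := hw0
      have hcw : (starRingEnd ℂ) (w 0) ≠ 0 := by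
        intro h
        have : w 0 = 0 := by simpa using h
        exact axisEllipse_ne_zero ha hc x.1 (by rw [← hw0', this]; simp)
      have hw'0 : w' 0 = U x * (starRingEnd ℂ) (w 0) := by
        rw [hU, ← hvel, innerVel, div_mul_cancel₀ _ hcw]
      have hsol := hF.eq_of_ode H.deriv_pos (fun t ht => by rw [hΩ]; exact H.deriv_vel t ht)
      have hyZ : ∀ t ∈ Icc 0 T₁, innerPos w t = Z x t ∧ innerVel w w' t = V x t := fun t ht => by
        obtain ⟨h1, h2⟩ := hsol t ht
        rw [hw'0] at h1 h2
        rw [innerPos, innerVel, h1, h2]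
        exact hgood x (w 0) hw0' t
      -- An earlier end would lie strictly inside the domain; a later one would put a boundary point
      -- at an interior time of the arc.
      have hTT : T₁ = T x := by
        rcases lt_trichotomy T₁ (T x) with h | h | h
        · have h1 := hpx T₁ ⟨H.pos, h⟩
          rw [← (hyZ T₁ ⟨H.pos.le, le_rfl⟩).1, hwT, axisForm_axisEllipse ha hc] at h1
          simp at h1
        · exact h
        · have h1 : axisForm a c (innerPos w (T x)) < 1 := H.inside (T x) ⟨hTx, h⟩
          rw [(hyZ (T x) ⟨hTx.le, h.le⟩).1, ← hex', axisForm_axisEllipse ha hc] at h1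
          exact absurd h1 (lt_irrefl 1)
      subst hTT
      have := hyZ (T x) ⟨hTx.le, le_rfl⟩
      rw [this.1, this.2]
      exact ⟨hex'.symm, hσx.symm⟩
  · obtain ⟨hTx, hpx, hex', hσx⟩ := hev.self_of_nhds
    obtain ⟨w, w', harc, hw⟩ := hex 0 hpos.self_of_nhds hsmall.self_of_nhds hTx hpx
    refine ⟨w, w', T 0, harc, by rw [(hw 0).1, hZx0]; exact hγ0, ?_, ?_, ?_, fun s hs => ?_⟩
    · have hZ00 : Z 0 0 = (a : ℂ) := by rw [hZx0]; exact hγ0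
      have hV0 : V 0 0 = ((-u : ℝ) : ℂ) := by
        have : (a : ℂ) ≠ 0 := by exact_mod_cast ha.ne'
        simp only [hV, hZ₁base, hZ00, hF.C_zero, hF.S_zero, Complex.norm_real, Real.norm_eq_abs,
          abs_of_pos ha]
        push_cast
        field_simp
        ring
      rw [(hw 0).2, hV0]
      simp [unitTangent_re]
    · rw [(hw _).1, hT0, hZT]
    · rw [he0, hσ0] at hσx
      rw [(hw _).2]
      exact hσx.symm
    · exact ⟨(C s - u * S s) ^ 2, sq_nonneg _, by rw [(hw s).1, hZbase]; push_cast; ring⟩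

/-! ### The return map and its linearisation. -/

theorem inner_launchVel {E ω a c : ℝ} (ha : 0 < a) (hc : 0 < c) {x : ℝ × ℝ}
    (hV : 0 < outerPotential E ω (axisEllipse a c x.1)) :
    inner ℝ (launchVel E ω (axisEllipse a c) x / (‖launchVel E ω (axisEllipse a c) x‖ : ℂ))
      (unitTangent (axisEllipse a c) x.1) = Real.sin x.2 := by
  have hu : 0 < Real.sqrt (2 * outerPotential E ω (axisEllipse a c x.1)) :=
    Real.sqrt_pos.mpr (by linarith)
  have ht := normSq_unitTangent ha hc x.1
  obtain ⟨h1, h2⟩ := unitNormal_eq a c x.1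
  have hn : ‖(Real.cos x.2 : ℂ) * unitNormal (axisEllipse a c) x.1 +
      (Real.sin x.2 : ℂ) * unitTangent (axisEllipse a c) x.1‖ = 1 := by
    refine (pow_eq_one_iff_of_nonneg (norm_nonneg _) two_ne_zero).mp ?_
    rw [← Complex.normSq_eq_norm_sq, Complex.normSq_apply]
    simp only [Complex.add_re, Complex.add_im, Complex.re_ofReal_mul, Complex.im_ofReal_mul, h1, h2]
    linear_combination ((unitTangent (axisEllipse a c) x.1).re ^ 2 +
      (unitTangent (axisEllipse a c) x.1).im ^ 2) * Real.sin_sq_add_cos_sq x.2 + ht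
  rw [launchVel, norm_mul, hn, Complex.norm_real, Real.norm_eq_abs, abs_of_pos hu, mul_one,
    mul_div_cancel_left₀ _ (by exact_mod_cast hu.ne'), real_inner_complex]
  simp only [Complex.add_re, Complex.add_im, Complex.re_ofReal_mul, Complex.im_ofReal_mul, h1, h2]
  linear_combination Real.sin x.2 * ht

/-- Snell's law multiplies the tangential component by a factor depending on the boundary point. At
perpendicular incidence that component is zero, so only the value of the factor is felt. -/
theorem hasGrad_mul_snd {K : ℝ → ℝ} (hK : ContDiffAt ℝ 1 K 0) :
    HasGrad (fun x => K x.1 * x.2) 0 (K 0) := by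
  have h : ContDiffAt ℝ 1 (fun x : ℝ × ℝ => K x.1) 0 :=
    ContDiffAt.comp (0 : ℝ × ℝ) (g := K) hK contDiffAt_fst
  exact (hasGrad_snd.mul_of_zero rfl h).congr (by simp) (by simp)

open Filter Topology Set in
/-- The return map near the homothetic orbit through the vertex `a` of the ellipse with semiaxes
`a` and `c`, with its linearisation. -/
theorem exists_returnMap {E h μ ω a c vE vI : ℝ} (hE : 0 < E) (hμ : 0 < μ) (hω : 0 < ω)
    (hEh : 0 < E + h) (ha : 0 < a) (hc : 0 < c) (hvE : 0 < vE) (hvI : 0 < vI)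
    (hE2 : vE ^ 2 = outerPotential E ω (a : ℂ)) (hI2 : vI ^ 2 = innerPotential E h μ (a : ℂ)) :
    HasHomotheticOrbit E h μ ω (axisDomain a c) (axisEllipse a c) 0 ∧
    ∃ f g : ℝ × ℝ → ℝ, ∃ f₁ f₂ g₁ g₂ : ℝ, f 0 = 0 ∧ g 0 = 0 ∧ HasGrad f f₁ f₂ ∧ HasGrad g g₁ g₂ ∧
      f₁ * g₂ - f₂ * g₁ = 1 ∧
      (f₁ + g₂) ^ 2 - 4 = 16 / (E ^ 2 * μ ^ 2) * (vI - vE) * (a ^ 2 / c ^ 2 - 1) *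
        (E - (a ^ 2 / c ^ 2 - 1) * (vI - vE) * vE) *
        (-μ * vE + 2 * a * (E - (a ^ 2 / c ^ 2 - 1) * (vI - vE) * vE) * vI) *
        (μ + 2 * a * (a ^ 2 / c ^ 2 - 1) * vI * (vI - vE)) ∧
      ∀ᶠ x in 𝓝 (0 : ℝ × ℝ), ∀ q, IsReturn E h μ ω (axisDomain a c) (axisEllipse a c) x q ↔
        axisEllipse a c q.1 = axisEllipse a c (f x) ∧ q.2 = g x := by
  -- The actual speeds at the vertex are `v = √2 vE` and `u = √2 vI`.
  obtain ⟨v, hv0, hv2⟩ : ∃ v : ℝ, 0 < v ∧ v ^ 2 = 2 * vE ^ 2 :=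
    ⟨Real.sqrt (2 * vE ^ 2), Real.sqrt_pos.mpr (by positivity), Real.sq_sqrt (by positivity)⟩
  obtain ⟨u, hu0, hu2⟩ : ∃ u : ℝ, 0 < u ∧ u ^ 2 = 2 * vI ^ 2 :=
    ⟨Real.sqrt (2 * vI ^ 2), Real.sqrt_pos.mpr (by positivity), Real.sq_sqrt (by positivity)⟩
  have hv : v ^ 2 / 2 = outerPotential E ω (a : ℂ) := by rw [← hE2]; linarith
  have hu : u ^ 2 / 2 = innerPotential E h μ (a : ℂ) := by rw [← hI2]; linarith
  obtain ⟨e, σ, e₁, e₂, he0, hσ0, he₁, he₂, heG, hσG, hO, yb, yb', TEb, hyb, hyb0, hyb'0, hybT, hybσ,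
    hybr⟩ := exists_outer_transition (c := c) hE hω ha hc hv0 hv
  obtain ⟨d, ρ, C₀, S₀, d₁, d₂, hd0, hρ0, hC₀, hS₀, hd₁, hd₂, hdG, hρG, hI, wb, wb', TIb, hwb, hwb0,
    hwb'0, hwbT, hwbσ, hwbr⟩ := exists_inner_transition (c := c) hEh hμ ha hc hu0 hu
  have hVE0 : 0 < outerPotential E ω (axisEllipse a c 0) := by
    rw [axisEllipse_zero, ← hE2]; positivity
  have hVI0 : 0 < innerPotential E h μ (axisEllipse a c 0) := by
    rw [axisEllipse_zero, ← hI2]; positivity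
  have hsE : Real.sqrt (outerPotential E ω (axisEllipse a c 0)) = vE := by
    rw [axisEllipse_zero, ← hE2, Real.sqrt_sq hvE.le]
  have hsI : Real.sqrt (innerPotential E h μ (axisEllipse a c 0)) = vI := by
    rw [axisEllipse_zero, ← hI2, Real.sqrt_sq hvI.le]
  have hta : ω ^ 2 * a ^ 2 = 2 * (E - vE ^ 2) := by
    simp only [outerPotential, Complex.norm_real, Real.norm_eq_abs, sq_abs] at hE2
    linarith
  have htE : 2 * (E + h) = u ^ 2 - 2 * μ / a := by
    simp only [innerPotential, Complex.norm_real, Real.norm_eq_abs, abs_of_pos ha] at hI2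
    linear_combination -2 * hI2 - hu2
  have he₁' : e₁ = 1 - 2 * vE ^ 2 / E + 2 * vE ^ 2 * a ^ 2 / (E * c ^ 2) := by
    rw [he₁, hv2]
    field_simp
    linear_combination c ^ 2 * hta
  have he₂' : e₂ = 2 * vE ^ 2 * a / (E * c) := by
    rw [he₂, hv2]
    ring
  have hd₁' : d₁ = 1 - 2 * a * u ^ 2 / μ + 2 * a ^ 3 * u ^ 2 / (μ * c ^ 2) := by
    rw [hd₁, hC₀, hS₀, htE]
    field_simp
    ring
  have hd₂' : d₂ = -(2 * a ^ 2 * u ^ 2 / (μ * c)) := by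
    rw [hd₂, hC₀, hS₀, htE]
    field_simp
    ring
  -- The energy relation makes the two diagonal entries of the outer matrix both `e₁`, as time
  -- reversal of arcs requires; the inner matrix likewise has `d₁` twice.
  replace hσG := hσG.congr (l' := 2 * (vE ^ 2 - E) * c / (a * E) + 2 * a / c - 4 * a * vE ^ 2 / (E * c)
    + 2 * a ^ 3 * vE ^ 2 / (E * c ^ 3)) (m' := e₁)
    (by
      rw [he₁', hv2]
      field_simp
      linear_combination (a ^ 2 * c ^ 2 - 2 * c ^ 4) * hta)
    (by
      rw [he₂', he₁', hv2]
      field_simp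
      linear_combination c ^ 2 * hta)
  replace hρG := hρG.congr (l' := -(2 * (a * u ^ 2 - μ) * c / (a * μ)) - 2 * a / c
    + 4 * a ^ 2 * u ^ 2 / (μ * c) - 2 * a ^ 4 * u ^ 2 / (μ * c ^ 3)) (m' := d₁)
    (by
      rw [hd₁', hC₀, hS₀, htE]
      field_simp
      ring)
    (by
      rw [hd₂', hd₁', hC₀, hS₀, htE]
      field_simp
      ring)
  have hcE := (contDiff_outerPotential E ω ha hc).contDiffAt (x := 0) |>.sqrt hVE0.ne'
  have hcI := (contDiff_innerPotential E h μ ha hc).contDiffAt (x := 0) |>.sqrt hVI0.ne'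
  have hnE : Real.sqrt (outerPotential E ω (axisEllipse a c 0)) ≠ 0 := by rw [hsE]; exact hvE.ne'
  have hnI : Real.sqrt (innerPotential E h μ (axisEllipse a c 0)) ≠ 0 := by rw [hsI]; exact hvI.ne'
  -- `K` is the Snell factor on entering the domain and `K'` the one on leaving it.
  set K : ℝ → ℝ := fun η => Real.sqrt (outerPotential E ω (axisEllipse a c η)) /
    Real.sqrt (innerPotential E h μ (axisEllipse a c η)) with hK
  set K' : ℝ → ℝ := fun η => Real.sqrt (innerPotential E h μ (axisEllipse a c η)) /
    Real.sqrt (outerPotential E ω (axisEllipse a c η)) with hK'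
  have hKs : HasGrad (fun x => K x.1 * x.2) 0 (vE / vI) :=
    (hasGrad_mul_snd (hcE.div hcI hnI)).congr rfl (by rw [← hsE, ← hsI]; rfl)
  have hKs' : HasGrad (fun x => K' x.1 * x.2) 0 (vI / vE) :=
    (hasGrad_mul_snd (hcI.div hcE hnE)).congr rfl (by rw [← hsE, ← hsI]; rfl)
  set s : ℝ × ℝ → ℝ := fun x => K (e x) * σ x with hs
  have hsG := hKs.comp₂ heG hσG he0 hσ0
  have hs0 : s 0 = 0 := by simp [hs, hσ0]
  set f : ℝ × ℝ → ℝ := fun x => d (e x, s x) with hf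
  set r : ℝ × ℝ → ℝ := fun x => ρ (e x, s x) with hr
  have hfG := hdG.comp₂ heG hsG he0 hs0
  have hrG := hρG.comp₂ heG hsG he0 hs0
  have hf0 : f 0 = 0 := by simp only [hf, he0, hs0]; exact hd0
  have hr0 : r 0 = 0 := by simp only [hr, he0, hs0]; exact hρ0
  have hprodG := hKs'.comp₂ hfG hrG hf0 hr0
  have hasin : HasStrictDerivAt Real.arcsin 1 0 := by
    simpa using Real.hasStrictDerivAt_arcsin (x := 0) (by norm_num) (by norm_num)
  have hgG := hprodG.comp hasin (by change K' (f 0) * r 0 = 0; rw [hr0, mul_zero])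
  refine ⟨?_, f, fun x => Real.arcsin (K' (f x) * r x), _, _, _, _, hf0, by simp [hr0], hfG, hgG,
    ?_, ?_, ?_⟩
  · refine ⟨yb, yb', TEb, wb, wb', TIb, ⟨hyb, hwb, ?_, ?_, by rw [hyb0]; exact (axisEllipse_zero a c).symm,
      hyb'0, ⟨0, by rw [hybT, axisEllipse_zero], by rw [hwb0, axisEllipse_zero], ?_⟩,
      by rw [hwbT]; exact (axisEllipse_zero a c).symm, ?_⟩, ?_, ?_⟩
    · exact ⟨by simp; positivity, by simp; positivity⟩
    · exact ⟨by simp; positivity, by simp; positivity⟩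
    · rw [Snell, hybσ, hwb'0, mul_zero, mul_zero]
    · have h1 := inner_launchVel (x := (0, 0)) ha hc hVE0
      simp only [Real.sin_zero] at h1
      rw [Snell]
      simp only [h1, hwbσ, mul_zero]
    · simpa only [axisEllipse_zero] using hybr
    · simpa only [axisEllipse_zero] using hwbr
  -- Both arc matrices have determinant one at the vertex, and the two Snell factors are inverse to
  -- each other.
  · rw [hd₁', hd₂', he₁', he₂', hu2]
    field_simp
    ring
  · rw [hd₁', hd₂', he₁', he₂', hu2]
    field_simp
    ring
  · have hec : ContinuousAt e 0 := HasStrictFDerivAt.continuousAt heG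
    have hfc : ContinuousAt f 0 := HasStrictFDerivAt.continuousAt hfG
    have hsc : ContinuousAt s 0 := HasStrictFDerivAt.continuousAt hsG
    have hpc : ContinuousAt (fun x => K' (f x) * r x) 0 := HasStrictFDerivAt.continuousAt hprodG
    have hes : Tendsto (fun x => (e x, s x)) (𝓝 0) (𝓝 0) := by
      have h1 := hec.prodMk hsc
      have h2 : (e 0, s 0) = 0 := by rw [he0, hs0]; rfl
      rw [ContinuousAt, h2] at h1
      exact h1
    have het : Tendsto e (𝓝 0) (𝓝 0) := by rw [← he0]; exact he0 ▸ hec.tendsto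
    have hft : Tendsto f (𝓝 0) (𝓝 0) := by rw [← hf0]; exact hf0 ▸ hfc.tendsto
    have hPE := (contDiff_outerPotential E ω ha hc).continuous.continuousAt (x := 0)
    have hPI := (contDiff_innerPotential E h μ ha hc).continuous.continuousAt (x := 0)
    have hpE := hPE.eventually (lt_mem_nhds hVE0)
    have hpI := hPI.eventually (lt_mem_nhds hVI0)
    have hpi := Real.pi_pos
    have hα : ∀ᶠ x : ℝ × ℝ in 𝓝 0, x.2 ∈ Icc (-(Real.pi / 2)) (Real.pi / 2) :=
      continuous_snd.continuousAt.eventually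
        (Icc_mem_nhds (by simp only [Prod.snd_zero]; linarith) (by simp only [Prod.snd_zero]; linarith))
    have hone : ∀ᶠ x : ℝ × ℝ in 𝓝 0, K' (f x) * r x ∈ Icc (-1 : ℝ) 1 :=
      hpc.eventually (Icc_mem_nhds (by change -1 < K' (f 0) * r 0; rw [hr0]; norm_num)
        (by change K' (f 0) * r 0 < 1; rw [hr0]; norm_num))
    filter_upwards [hO, hes.eventually hI, hα, hone, het.eventually hpE, het.eventually hpI,
      hft.eventually hpE, hft.eventually hpI] with x hOx hIx hαx h1x hEe hIe hEf hIf q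
    have qEe := Real.sqrt_pos.mpr hEe
    have qIe := Real.sqrt_pos.mpr hIe
    have qEf := Real.sqrt_pos.mpr hEf
    have qIf := Real.sqrt_pos.mpr hIf
    have hse : Real.sqrt (outerPotential E ω (axisEllipse a c (e x))) * σ x =
        Real.sqrt (innerPotential E h μ (axisEllipse a c (e x))) * s x := by
      simp only [hs, hK]
      field_simp
    have hsf : Real.sqrt (outerPotential E ω (axisEllipse a c (f x))) * (K' (f x) * r x) =
        Real.sqrt (innerPotential E h μ (axisEllipse a c (f x))) * r x := by
      simp only [hK']
      field_simp
    constructor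
    · rintro ⟨y, y', TE, w, w', TI, H⟩
      obtain ⟨ξ, hyξ, hwξ, hsn⟩ := H.junction
      obtain ⟨hy1, hy2⟩ := hOx.2 y y' TE ξ H.outer H.start_pos H.start_vel hyξ
      have hξ : axisEllipse a c ξ = axisEllipse a c (e x) := by rw [← hyξ, hy1]
      have htξ : unitTangent (axisEllipse a c) ξ = unitTangent (axisEllipse a c) (e x) :=
        unitTangent_congr ((axisEllipse_inj ha hc).mp hξ).1 ((axisEllipse_inj ha hc).mp hξ).2
      rw [Snell, hξ, htξ, hy2, hse] at hsn
      have hw0 := (mul_left_cancel₀ qIe.ne' hsn).symm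
      obtain ⟨hw1, hw2⟩ := hIx.2 w w' TI q.1 H.inner (by rw [hwξ, hξ]) hw0 H.end_pos
      have hq : axisEllipse a c q.1 = axisEllipse a c (f x) := by rw [← H.end_pos, hw1]
      have htq : unitTangent (axisEllipse a c) q.1 = unitTangent (axisEllipse a c) (f x) :=
        unitTangent_congr ((axisEllipse_inj ha hc).mp hq).1 ((axisEllipse_inj ha hc).mp hq).2
      refine ⟨hq, ?_⟩
      have hsn' := H.end_vel
      rw [Snell, inner_launchVel ha hc (by rw [hq]; exact hEf), hq, htq] at hsn'
      change _ = _ * inner ℝ _ (unitTangent (axisEllipse a c) (d (e x, s x))) at hsn'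
      rw [hw2] at hsn'
      change _ = _ * r x at hsn'
      rw [← hsf] at hsn'
      -- Snell's law fixes only `sin q.2`; the constraint on the final angle makes the arcsine the
      -- unique solution.
      exact (Real.arcsin_eq_of_sin_eq (mul_left_cancel₀ qEf.ne' hsn') H.angle_end).symm
    · rintro ⟨hq, hq2⟩
      have htq : unitTangent (axisEllipse a c) q.1 = unitTangent (axisEllipse a c) (f x) :=
        unitTangent_congr ((axisEllipse_inj ha hc).mp hq).1 ((axisEllipse_inj ha hc).mp hq).2
      obtain ⟨y, y', TE, hy, hy0, hy'0, hyT, hyσ⟩ := hOx.1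
      obtain ⟨w, w', TI, hw, hw0, hw'0, hwT, hwσ⟩ := hIx.1
      refine ⟨y, y', TE, w, w', TI, hy, hw, hαx, ?_, hy0, hy'0, ⟨e x, hyT, hw0, ?_⟩, ?_, ?_⟩
      · rw [hq2]; exact Real.arcsin_mem_Icc _
      · rw [Snell, hyσ, hse]
        congr 1
        exact hw'0.symm
      · rw [hwT, hq]
      · rw [Snell, inner_launchVel ha hc (by rw [hq]; exact hEf), hq, htq, hq2,
          Real.sin_arcsin h1x.1 h1x.2, hsf]
        congr 1
        exact hwσ.symm

/-! ### Linear maps of the plane with determinant one -/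

section Linear
variable {A : (ℝ × ℝ) →L[ℝ] (ℝ × ℝ)} {p q r s : ℝ}

theorem charpoly_of_apply (hA : ∀ x, A x = (p * x.1 + q * x.2, r * x.1 + s * x.2)) :
    (A : (ℝ × ℝ) →ₗ[ℝ] (ℝ × ℝ)).charpoly =
      Polynomial.X ^ 2 - Polynomial.C (p + s) * Polynomial.X + Polynomial.C (p * s - q * r) := by
  have hM : LinearMap.toMatrix (Module.Basis.finTwoProd ℝ) (Module.Basis.finTwoProd ℝ)
      (A : (ℝ × ℝ) →ₗ[ℝ] (ℝ × ℝ)) = !![p, q; r, s] := by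
    ext i j
    fin_cases i <;> fin_cases j <;> simp [LinearMap.toMatrix_apply, hA]
  rw [← LinearMap.charpoly_toMatrix (A : (ℝ × ℝ) →ₗ[ℝ] (ℝ × ℝ)) (Module.Basis.finTwoProd ℝ), hM,
    Matrix.charpoly_fin_two]
  simp [Matrix.trace_fin_two, Matrix.det_fin_two]

theorem charDiscr_of_apply (hA : ∀ x, A x = (p * x.1 + q * x.2, r * x.1 + s * x.2))
    (hdet : p * s - q * r = 1) : charDiscr A = (p + s) ^ 2 - 4 := by
  simp only [charDiscr, charpoly_of_apply hA, hdet, discrim]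
  simp [Polynomial.coeff_X, Polynomial.coeff_C, Polynomial.coeff_one]
  ring

theorem hasEigenvalue_iff_of_apply (hA : ∀ x, A x = (p * x.1 + q * x.2, r * x.1 + s * x.2))
    (hdet : p * s - q * r = 1) (l : ℝ) :
    Module.End.HasEigenvalue (A : (ℝ × ℝ) →ₗ[ℝ] (ℝ × ℝ)) l ↔ l ^ 2 - (p + s) * l + 1 = 0 := by
  rw [Module.End.hasEigenvalue_iff_isRoot_charpoly, charpoly_of_apply hA, hdet]
  simp [Polynomial.IsRoot]

theorem isSaddle_iff_of_apply (hA : ∀ x, A x = (p * x.1 + q * x.2, r * x.1 + s * x.2))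
    (hdet : p * s - q * r = 1) : IsSaddle A ↔ 0 < (p + s) ^ 2 - 4 := by
  simp only [IsSaddle, hasEigenvalue_iff_of_apply hA hdet]
  set t := p + s
  constructor
  · rintro ⟨l, hl, h1, -⟩
    have hl0 : l ≠ 0 := by rintro rfl; simp at hl; linarith
    have hl2 : 1 < l ^ 2 := by rw [← sq_abs]; nlinarith
    -- The characteristic equation reads `t l = l² + 1`; squaring it gives the sign of `t² - 4`.
    have e : l ^ 2 * (t ^ 2 - 4) = (l ^ 2 - 1) ^ 2 := by
      have : t * l = l ^ 2 + 1 := by linarith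
      linear_combination (t * l + l ^ 2 + 1) * this
    have h3 : 0 < (l ^ 2 - 1) ^ 2 := by
      have : 0 < l ^ 2 - 1 := by linarith
      positivity
    rw [← e] at h3
    exact (pos_iff_pos_of_mul_pos h3).mp (by positivity)
  · intro h
    have hsq := Real.sq_sqrt h.le
    have hsp := Real.sqrt_pos.mpr h
    set d := Real.sqrt (t ^ 2 - 4)
    -- Of two roots with product one, the larger in modulus exceeds `1`. The sign of `t` decides
    -- below which of `(t ± d) / 2` it is.
    have key : ∀ l m : ℝ, l + m = t → l * m = 1 → m ^ 2 < l ^ 2 →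
        ∃ l : ℝ, 1 < |l| ∧ l ^ 2 - t * l + 1 = 0 ∧ l⁻¹ ^ 2 - t * l⁻¹ + 1 = 0 := by
      intro l m hs hm hlt
      have hinv : l⁻¹ = m := inv_eq_of_mul_eq_one_right hm
      refine ⟨l, ?_, ?_, ?_⟩
      · rw [← one_lt_sq_iff_one_lt_abs]
        have h1 : l ^ 2 * m ^ 2 = 1 := by rw [← mul_pow, hm, one_pow]
        by_contra hcon
        push Not at hcon
        nlinarith [sq_nonneg m, sq_nonneg l]
      · rw [← hs]; linear_combination -hm
      · rw [hinv, ← hs]; linear_combination -hm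
    rcases lt_or_ge 0 t with ht | ht
    · exact key ((t + d) / 2) ((t - d) / 2) (by ring) (by linear_combination -hsq / 4)
        (by nlinarith [mul_pos ht hsp])
    · have ht' : t < 0 := lt_of_le_of_ne ht (by rintro h0; rw [h0] at h; norm_num at h)
      exact key ((t - d) / 2) ((t + d) / 2) (by ring) (by linear_combination -hsq / 4)
        (by nlinarith [mul_pos_of_neg_of_neg ht' (neg_neg_of_pos hsp)])

theorem isCenter_iff_of_apply (hA : ∀ x, A x = (p * x.1 + q * x.2, r * x.1 + s * x.2))
    (hdet : p * s - q * r = 1) : IsCenter A ↔ (p + s) ^ 2 - 4 < 0 := by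
  simp only [IsCenter, charpoly_of_apply hA, hdet]
  set t := p + s
  have hmap : (Polynomial.X ^ 2 - Polynomial.C t * Polynomial.X + Polynomial.C 1 :
      Polynomial ℝ).map (algebraMap ℝ ℂ) =
      Polynomial.X ^ 2 - Polynomial.C (t : ℂ) * Polynomial.X + Polynomial.C 1 := by
    simp
  rw [hmap]
  constructor
  · rintro ⟨l, hl, hn, hr⟩
    have hmem : l ∈ (Polynomial.X ^ 2 - Polynomial.C (t : ℂ) * Polynomial.X +
        Polynomial.C 1 : Polynomial ℂ).roots := by rw [hr]; simp
    have hroot := Polynomial.isRoot_of_mem_roots hmem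
    simp only [Polynomial.IsRoot, Polynomial.eval_add, Polynomial.eval_sub, Polynomial.eval_pow,
      Polynomial.eval_X, Polynomial.eval_mul, Polynomial.eval_C] at hroot
    have him := congrArg Complex.im hroot
    simp [pow_two] at him
    have h1 : t = 2 * l.re := by
      have : l.im * (2 * l.re - t) = 0 := by linear_combination him
      rcases mul_eq_zero.mp this with h | h
      · exact absurd h hl
      · linarith
    have h2 : l.re ^ 2 + l.im ^ 2 = 1 := by
      have : ‖l‖ ^ 2 = 1 := by rw [hn, one_pow]
      rw [← Complex.normSq_eq_norm_sq, Complex.normSq_apply] at this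
      linarith
    have h3 : 0 < l.im ^ 2 := by positivity
    rw [h1]
    nlinarith
  · intro h
    have hsp : 0 < 4 - t ^ 2 := by linarith
    have hsq := Real.sq_sqrt hsp.le
    have hdp := Real.sqrt_pos.mpr hsp
    set d := Real.sqrt (4 - t ^ 2)
    refine ⟨⟨t / 2, d / 2⟩, by simpa using hdp.ne', ?_, ?_⟩
    · refine (pow_eq_one_iff_of_nonneg (norm_nonneg _) two_ne_zero).mp ?_
      rw [← Complex.normSq_eq_norm_sq, Complex.normSq_apply]
      simp only
      linear_combination hsq / 4
    · set l : ℂ := ⟨t / 2, d / 2⟩ with hl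
      have e1 : l + (starRingEnd ℂ) l = (t : ℂ) := by
        apply Complex.ext <;> simp [hl]
      have e2 : l * (starRingEnd ℂ) l = 1 := by
        apply Complex.ext
        · simp [hl]; linear_combination hsq / 4
        · simp [hl]; ring
      have : (Polynomial.X ^ 2 - Polynomial.C (t : ℂ) * Polynomial.X + Polynomial.C 1 :
          Polynomial ℂ) = (Polynomial.X - Polynomial.C l) *
            (Polynomial.X - Polynomial.C ((starRingEnd ℂ) l)) := by
        rw [← e1, ← e2, Polynomial.C_add, Polynomial.C_mul]
        ring
      rw [this, Polynomial.roots_mul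
        (mul_ne_zero (Polynomial.X_sub_C_ne_zero _) (Polynomial.X_sub_C_ne_zero _)),
        Polynomial.roots_X_sub_C, Polynomial.roots_X_sub_C]
      rfl

theorem not_isLinearlyStable_of_isSaddle (h : IsSaddle A) : ¬ IsLinearlyStable A := by
  rintro ⟨C, hC⟩
  obtain ⟨l, hl, hev, -⟩ := h
  obtain ⟨v, hv⟩ := hev.exists_hasEigenvector
  have hAv : A v = l • v := hv.apply_eq_smul
  have hpow : ∀ n : ℕ, (A ^ n) v = l ^ n • v := by
    intro n
    induction n with
    | zero => simp
    | succ n ih =>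
      rw [pow_succ', mul_apply_eq_comp, ih, map_smul, hAv, smul_smul, pow_succ]
  have hvn : 0 < ‖v‖ := norm_pos_iff.mpr hv.2
  obtain ⟨n, hn⟩ := pow_unbounded_of_one_lt C hl
  have h1 := hC n v
  rw [hpow, norm_smul, norm_pow, Real.norm_eq_abs] at h1
  exact absurd (le_of_mul_le_mul_right h1 hvn) (not_le.mpr hn)

/-- Write `t = 2 cos θ`. Cayley–Hamilton and the addition formula for the sine give `sin θ Aⁿ =
sin(nθ) A - sin((n - 1)θ)`, which is bounded in `n`. -/
theorem isLinearlyStable_of_apply (hA : ∀ x, A x = (p * x.1 + q * x.2, r * x.1 + s * x.2))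
    (hdet : p * s - q * r = 1) (ht : (p + s) ^ 2 - 4 < 0) : IsLinearlyStable A := by
  set t := p + s with htdef
  have hlt : |t / 2| < 1 := by
    rw [abs_lt]
    constructor <;> nlinarith
  rw [abs_lt] at hlt
  set θ := Real.arccos (t / 2)
  have hcos : 2 * Real.cos θ = t := by rw [Real.cos_arccos hlt.1.le hlt.2.le]; ring
  have hsin : 0 < Real.sin θ := by
    rw [Real.sin_arccos]
    exact Real.sqrt_pos.mpr (by nlinarith)
  have hAA : ∀ v, A (A v) = t • A v - v := by
    intro v
    rw [hA (A v), hA v]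
    ext
    · simp [htdef]; linear_combination (-v.1) * hdet
    · simp [htdef]; linear_combination (-v.2) * hdet
  have key : ∀ (n : ℕ) v, Real.sin θ • (A ^ n) v =
      Real.sin (n * θ) • A v - Real.sin (n * θ - θ) • v := by
    intro n v
    induction n with
    | zero => simp
    | succ n ih =>
      have e1 : Real.sin ((n + 1 : ℕ) * θ) = t * Real.sin (n * θ) - Real.sin (n * θ - θ) := by
        push_cast
        rw [← hcos, add_mul, one_mul, Real.sin_add, Real.sin_sub]
        ring
      have e2 : ((n + 1 : ℕ) : ℝ) * θ - θ = n * θ := by push_cast; ring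
      rw [pow_succ', mul_apply_eq_comp, ← map_smul, ih, map_sub, map_smul, map_smul,
        hAA, e1, e2]
      module
  refine ⟨(‖A‖ + 1) / Real.sin θ, fun n v => ?_⟩
  rw [div_mul_eq_mul_div, le_div_iff₀ hsin]
  have h1 : ‖(A ^ n) v‖ * Real.sin θ = ‖Real.sin θ • (A ^ n) v‖ := by
    rw [norm_smul, Real.norm_eq_abs, abs_of_pos hsin, mul_comm]
  rw [h1, key]
  refine (norm_sub_le _ _).trans ?_
  rw [norm_smul, norm_smul, Real.norm_eq_abs, Real.norm_eq_abs, add_mul, one_mul]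
  refine add_le_add ?_ ?_
  · exact (mul_le_of_le_one_left (norm_nonneg _) (Real.abs_sin_le_one _)).trans (A.le_opNorm v)
  · exact mul_le_of_le_one_left (norm_nonneg _) (Real.abs_sin_le_one _)

end Linear

/-! ### Rotations -/

section Rotation
variable {E h μ ω δ : ℝ} {D₁ D₂ : Set ℂ} {γ₁ γ₂ : ℝ → ℂ} {s : ℂ}

theorem unitTangent_rotate (hs : ‖s‖ = 1) (hγ : ∀ ξ, γ₂ ξ = s ^ 2 * γ₁ (ξ - δ)) (ξ : ℝ) :
    unitTangent γ₂ (ξ + δ) = s ^ 2 * unitTangent γ₁ ξ := by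
  have h1 : deriv γ₂ (ξ + δ) = s ^ 2 * deriv γ₁ ξ := by
    rw [funext hγ, deriv_const_mul_field, deriv_comp_sub_const (f := γ₁), add_sub_cancel_right]
  rw [unitTangent, unitTangent, h1, norm_mul, norm_pow, hs, one_pow, one_mul, mul_div_assoc]

theorem inner_mul_left_of_norm_one (hs : ‖s‖ = 1) (z w : ℂ) :
    inner ℝ (s ^ 2 * z) (s ^ 2 * w) = inner ℝ z w := by
  have h : ‖s ^ 2‖ ^ 2 = 1 := by rw [norm_pow, hs]; norm_num
  rw [← Complex.normSq_eq_norm_sq, Complex.normSq_apply] at h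
  simp only [real_inner_complex, Complex.mul_re, Complex.mul_im]
  linear_combination (z.re * w.re + z.im * w.im) * h

theorem snell_rotate (hs : ‖s‖ = 1) (hγ : ∀ ξ, γ₂ ξ = s ^ 2 * γ₁ (ξ - δ)) {ξ : ℝ} {vE vI : ℂ}
    (H : Snell E h μ ω γ₁ ξ vE vI) : Snell E h μ ω γ₂ (ξ + δ) (s ^ 2 * vE) (s ^ 2 * vI) := by
  have hn : ‖s ^ 2‖ = 1 := by rw [norm_pow, hs, one_pow]
  have hg : ‖γ₂ (ξ + δ)‖ = ‖γ₁ ξ‖ := by rw [hγ, add_sub_cancel_right, norm_mul, hn, one_mul]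
  simp only [Snell, outerPotential, innerPotential, hg, unitTangent_rotate hs hγ, norm_mul, hn,
    one_mul, mul_div_assoc, inner_mul_left_of_norm_one hs] at H ⊢
  exact H

theorem launchVel_rotate (hs : ‖s‖ = 1) (hγ : ∀ ξ, γ₂ ξ = s ^ 2 * γ₁ (ξ - δ)) (x : ℝ × ℝ) :
    launchVel E ω γ₂ (x + (δ, 0)) = s ^ 2 * launchVel E ω γ₁ x := by
  have hn : ‖s ^ 2‖ = 1 := by rw [norm_pow, hs, one_pow]
  have hg : ‖γ₂ (x.1 + δ)‖ = ‖γ₁ x.1‖ := by rw [hγ, add_sub_cancel_right, norm_mul, hn, one_mul]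
  simp only [launchVel, outerPotential, Prod.fst_add, Prod.snd_add, add_zero, hg, unitNormal,
    unitTangent_rotate hs hγ]
  ring

theorem innerPos_rotate (w : ℝ → ℂ) (τ : ℝ) :
    innerPos (fun τ => s * w τ) τ = s ^ 2 * innerPos w τ := by
  simp only [innerPos]
  ring

theorem innerVel_rotate (hs : ‖s‖ = 1) (w w' : ℝ → ℂ) (τ : ℝ) :
    innerVel (fun τ => s * w τ) (fun τ => s * w' τ) τ = s ^ 2 * innerVel w w' τ := by
  have h1 : s * (starRingEnd ℂ) s = 1 := by rw [Complex.mul_conj', hs]; simp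
  have h2 : (starRingEnd ℂ) s ≠ 0 := right_ne_zero_of_mul_eq_one h1
  simp only [innerVel, map_mul]
  rw [mul_div_mul_comm]
  congr 1
  rw [div_eq_iff h2]
  linear_combination (-s) * h1

/-- The rotation is written as `s²` so that the Levi-Civita variable can be turned by `s`; position
and physical velocity then both turn by `s²`. The potentials depend only on the distance to the
origin. -/
theorem isCycle_rotate (hs : ‖s‖ = 1) (hγ : ∀ ξ, γ₂ ξ = s ^ 2 * γ₁ (ξ - δ))
    (hD : ∀ z, s ^ 2 * z ∈ D₂ ↔ z ∈ D₁) {p q : ℝ × ℝ} {y y' w w' : ℝ → ℂ} {TE TI : ℝ}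
    (H : IsCycle E h μ ω D₁ γ₁ p q y y' TE w w' TI) :
    IsCycle E h μ ω D₂ γ₂ (p + (δ, 0)) (q + (δ, 0)) (fun t => s ^ 2 * y t) (fun t => s ^ 2 * y' t) TE
      (fun t => s * w t) (fun t => s * w' t) TI := by
  have hn : ‖s ^ 2‖ = 1 := by rw [norm_pow, hs, one_pow]
  have hs0 : s ^ 2 ≠ 0 := by
    intro h0
    rw [h0] at hn
    simp at hn
  have hγ' : ∀ ξ, γ₂ (ξ + δ) = s ^ 2 * γ₁ ξ := fun ξ => by rw [hγ, add_sub_cancel_right]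
  have hcl : ∀ z, s ^ 2 * z ∈ closure D₂ → z ∈ closure D₁ := fun z hz => by
    have h1 := (Homeomorph.mulLeft₀ (s ^ 2) hs0).preimage_closure D₂
    have h2 : (Homeomorph.mulLeft₀ (s ^ 2) hs0) ⁻¹' D₂ = D₁ := Set.ext hD
    rw [h2] at h1
    rw [← h1]
    exact hz
  obtain ⟨ξ, hj1, hj2, hj3⟩ := H.junction
  refine ⟨⟨H.outer.pos, fun t ht => (H.outer.deriv_pos t ht).const_mul _, fun t ht => ?_,
    fun t ht => ?_, fun t ht hc => H.outer.outside t ht (hcl _ hc)⟩,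
    ⟨H.inner.pos, fun t ht => (H.inner.deriv_pos t ht).const_mul _, fun t ht => ?_, fun t ht => ?_,
      fun t ht => ?_⟩, by simpa using H.angle_start, by simpa using H.angle_end, ?_, ?_,
      ⟨ξ + δ, ?_, ?_, ?_⟩, ?_, ?_⟩
  · refine ((H.outer.deriv_vel t ht).const_mul _).congr_deriv ?_
    ring
  · have := H.outer.energy t ht
    simpa only [outerPotential, norm_mul, hn, one_mul] using this
  · refine ((H.inner.deriv_vel t ht).const_mul _).congr_deriv ?_
    ring
  · have := H.inner.energy t ht
    simpa only [norm_mul, hs, one_mul] using this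
  · rw [mul_pow, hD]
    exact H.inner.inside t ht
  · rw [H.start_pos, Prod.fst_add, hγ']
  · rw [H.start_vel, launchVel_rotate hs hγ]
  · rw [hj1, hγ']
  · rw [innerPos_rotate, hj2, hγ']
  · rw [innerVel_rotate hs]
    exact snell_rotate hs hγ hj3
  · rw [innerPos_rotate, H.end_pos, Prod.fst_add, hγ']
  · rw [innerVel_rotate hs, launchVel_rotate hs hγ, Prod.fst_add]
    exact snell_rotate hs hγ H.end_vel

/-- The converse is the same transport applied with `s⁻¹` and `-δ`. -/
theorem isReturn_rotate (hs : ‖s‖ = 1) (hγ : ∀ ξ, γ₂ ξ = s ^ 2 * γ₁ (ξ - δ))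
    (hD : ∀ z, s ^ 2 * z ∈ D₂ ↔ z ∈ D₁) (p q : ℝ × ℝ) :
    IsReturn E h μ ω D₂ γ₂ p q ↔ IsReturn E h μ ω D₁ γ₁ (p - (δ, 0)) (q - (δ, 0)) := by
  constructor
  · rintro ⟨y, y', TE, w, w', TI, H⟩
    have hs0 : s ≠ 0 := by
      rintro rfl
      simp at hs
    have h1 := isCycle_rotate (s := s⁻¹) (δ := -δ) (γ₂ := γ₁) (D₂ := D₁) (by rw [norm_inv, hs, inv_one])
      (fun ξ => by rw [hγ, sub_neg_eq_add, add_sub_cancel_right]; field_simp)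
      (fun z => by rw [← hD]; field_simp) H
    have e : ∀ x : ℝ × ℝ, x + (-δ, 0) = x - (δ, 0) := fun x => by
      rw [sub_eq_add_neg]
      simp
    rw [e, e] at h1
    exact ⟨_, _, _, _, _, _, h1⟩
  · rintro ⟨y, y', TE, w, w', TI, H⟩
    have h1 := isCycle_rotate hs hγ hD H
    rw [sub_add_cancel, sub_add_cancel] at h1
    exact ⟨_, _, _, _, _, _, h1⟩

theorem hasHomotheticOrbit_rotate (hs : ‖s‖ = 1) (hγ : ∀ ξ, γ₂ ξ = s ^ 2 * γ₁ (ξ - δ))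
    (hD : ∀ z, s ^ 2 * z ∈ D₂ ↔ z ∈ D₁) (H : HasHomotheticOrbit E h μ ω D₁ γ₁ 0) :
    HasHomotheticOrbit E h μ ω D₂ γ₂ δ := by
  obtain ⟨y, y', TE, w, w', TI, H, hy, hw⟩ := H
  have h1 := isCycle_rotate hs hγ hD H
  simp only [Prod.mk_add_mk, zero_add, add_zero] at h1
  refine ⟨_, _, _, _, _, _, h1, fun t ht => ?_, fun t ht => ?_⟩
  · obtain ⟨r, hr, hyr⟩ := hy t ht
    exact ⟨r, hr, by rw [hyr, hγ, sub_self]; ring⟩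
  · obtain ⟨r, hr, hwr⟩ := hw t ht
    exact ⟨r, hr, by rw [innerPos_rotate, hwr, hγ, sub_self]; ring⟩

end Rotation

/-! ### Stability of the homothetic orbits -/

-- Transports the vertex computation to the direction `δ` by rotation and combines it with the
-- classification of plane maps of determinant one. The conclusions hold for every local return map,
-- because its germ is forced.
open Filter Topology Set in
theorem homothetic_stability {E h μ ω a c vE vI δ : ℝ} {D : Set ℂ} {γ : ℝ → ℂ} {s : ℂ}
    (hE : 0 < E) (hμ : 0 < μ) (hω : 0 < ω) (hEh : 0 < E + h) (ha : 0 < a) (hc : 0 < c)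
    (hvE : 0 < vE) (hvI : 0 < vI) (hE2 : vE ^ 2 = outerPotential E ω (a : ℂ))
    (hI2 : vI ^ 2 = innerPotential E h μ (a : ℂ)) (hs : ‖s‖ = 1)
    (hγ : ∀ ξ, γ ξ = s ^ 2 * axisEllipse a c (ξ - δ))
    (hD : ∀ z, s ^ 2 * z ∈ D ↔ z ∈ axisDomain a c) {Δ : ℝ}
    (hΔ : Δ = 16 / (E ^ 2 * μ ^ 2) * (vI - vE) * (a ^ 2 / c ^ 2 - 1) *
        (E - (a ^ 2 / c ^ 2 - 1) * (vI - vE) * vE) *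
        (-μ * vE + 2 * a * (E - (a ^ 2 / c ^ 2 - 1) * (vI - vE) * vE) * vI) *
        (μ + 2 * a * (a ^ 2 / c ^ 2 - 1) * vI * (vI - vE))) :
    HasHomotheticOrbit E h μ ω D γ δ ∧ (∃ F, IsLocalReturnMap E h μ ω D γ (δ, 0) F) ∧
      ∀ F, IsLocalReturnMap E h μ ω D γ (δ, 0) F →
        DifferentiableAt ℝ F (δ, 0) ∧
        charDiscr (fderiv ℝ F (δ, 0)) = Δ ∧
        (0 < Δ ↔ IsSaddle (fderiv ℝ F (δ, 0))) ∧
        (Δ < 0 ↔ IsCenter (fderiv ℝ F (δ, 0))) ∧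
        (0 < Δ → ¬ IsLinearlyStable (fderiv ℝ F (δ, 0))) ∧
        (Δ < 0 → IsLinearlyStable (fderiv ℝ F (δ, 0))) := by
  obtain ⟨hhom, f, g, f₁, f₂, g₁, g₂, hf0, hg0, hfG, hgG, hdet, htr, hret⟩ :=
    exists_returnMap hE hμ hω hEh ha hc hvE hvI hE2 hI2
  rw [← hΔ] at htr
  set F₀ : ℝ × ℝ → ℝ × ℝ := fun x => (f (x - (δ, 0)) + δ, g (x - (δ, 0))) with hF₀
  have hshift : HasFDerivAt (fun x : ℝ × ℝ => x - (δ, 0)) (ContinuousLinearMap.id ℝ (ℝ × ℝ)) (δ, 0) :=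
    (hasFDerivAt_id _).sub_const _
  have hzero : ((δ, 0) : ℝ × ℝ) - (δ, 0) = 0 := sub_self _
  have hfd : HasFDerivAt (fun x : ℝ × ℝ => f (x - (δ, 0))) _ (δ, 0) :=
    HasFDerivAt.comp (g := f) (δ, 0) (by rw [hzero]; exact HasStrictFDerivAt.hasFDerivAt hfG) hshift
  have hgd : HasFDerivAt (fun x : ℝ × ℝ => g (x - (δ, 0))) _ (δ, 0) :=
    HasFDerivAt.comp (g := g) (δ, 0) (by rw [hzero]; exact HasStrictFDerivAt.hasFDerivAt hgG) hshift
  have hF₀d := (hfd.add_const δ).prodMk hgd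
  have hγinj : ∀ ξ η, γ ξ = γ η ↔ axisEllipse a c (ξ - δ) = axisEllipse a c (η - δ) := fun ξ η => by
    have hs0 : s ^ 2 ≠ 0 := pow_ne_zero 2 (by rintro rfl; simp at hs)
    rw [hγ, hγ, mul_right_inj' hs0]
  have hF₀p : F₀ (δ, 0) = (δ, 0) := by simp only [hF₀, hzero, hf0, hg0, zero_add]
  have hF₀c : ContinuousAt F₀ (δ, 0) := hF₀d.continuousAt
  have hF₀r : ∀ᶠ x in 𝓝 ((δ, 0) : ℝ × ℝ), ∀ q : ℝ × ℝ,
      IsReturn E h μ ω D γ x q ↔ (γ q.1 = γ (F₀ x).1 ∧ q.2 = (F₀ x).2) := by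
    have ht : Tendsto (fun x : ℝ × ℝ => x - (δ, 0)) (𝓝 (δ, 0)) (𝓝 0) := by
      have := hshift.continuousAt.tendsto
      rwa [hzero] at this
    filter_upwards [ht.eventually hret] with x hx q
    rw [isReturn_rotate hs hγ hD, hx, hγinj]
    simp [hF₀]
  refine ⟨hasHomotheticOrbit_rotate hs hγ hD hhom, ⟨F₀, hF₀c, hF₀p, hF₀r⟩, fun F hF => ?_⟩
  -- Both maps give the same boundary point and angle. By continuity both parameters lie within `π /
  -- 2` of `δ`, where the sine is injective, so they agree exactly and not only modulo `2π`.
  have heq : F =ᶠ[𝓝 (δ, 0)] F₀ := by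
    have hpi := Real.pi_pos
    have hwin : ∀ {G : ℝ × ℝ → ℝ × ℝ}, ContinuousAt G (δ, 0) → G (δ, 0) = (δ, 0) →
        ∀ᶠ x in 𝓝 ((δ, 0) : ℝ × ℝ), (G x).1 - δ ∈ Icc (-(Real.pi / 2)) (Real.pi / 2) := by
      intro G hG hG0
      have h1 : ContinuousAt (fun x => (G x).1 - δ) (δ, 0) := hG.fst.sub continuousAt_const
      exact h1.eventually (Icc_mem_nhds (by simp only [hG0]; linarith) (by simp only [hG0]; linarith))
    filter_upwards [hF.return_iff, hF₀r, hwin hF.continuousAt hF.fixed, hwin hF₀c hF₀p]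
      with x hx hx₀ hw hw₀
    have h1 := (hx (F₀ x)).mp ((hx₀ (F₀ x)).mpr ⟨rfl, rfl⟩)
    have h2 := ((axisEllipse_inj ha hc).mp ((hγinj _ _).mp h1.1)).2
    have h3 := Real.injOn_sin hw₀ hw h2
    exact Prod.ext (by linarith) h1.2.symm
  have hFd := hF₀d.congr_of_eventuallyEq heq
  have hA : ∀ x, fderiv ℝ F (δ, 0) x = (f₁ * x.1 + f₂ * x.2, g₁ * x.1 + g₂ * x.2) := fun x => by
    rw [hFd.fderiv]
    simp
  refine ⟨hFd.differentiableAt, ?_, ?_, ?_, ?_, ?_⟩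
  · rw [charDiscr_of_apply hA hdet, htr]
  · rw [isSaddle_iff_of_apply hA hdet, htr]
  · rw [isCenter_iff_of_apply hA hdet, htr]
  · intro h1
    exact not_isLinearlyStable_of_isSaddle ((isSaddle_iff_of_apply hA hdet).mpr (by rwa [htr]))
  · intro h1
    exact isLinearlyStable_of_apply hA hdet (by rwa [htr])

/-! ### Curvature at the vertices and the main theorem. -/

theorem curvature_axisEllipse {a c : ℝ} (ξ : ℝ) :
    curvature (axisEllipse a c) ξ = a * c / axisSpeed a c ξ ^ 3 := by
  have h1 : deriv (axisEllipse a c) = fun ξ =>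
      ((-(a * Real.sin ξ) : ℝ) : ℂ) + ((c * Real.cos ξ : ℝ) : ℂ) * Complex.I :=
    funext fun ξ => (hasDerivAt_axisEllipse a c ξ).deriv
  have h2 : deriv (deriv (axisEllipse a c)) ξ =
      ((-(a * Real.cos ξ) : ℝ) : ℂ) + ((-(c * Real.sin ξ) : ℝ) : ℂ) * Complex.I := by
    rw [h1]
    refine HasDerivAt.deriv ?_
    refine ((((Real.hasDerivAt_sin ξ).const_mul a).neg.ofReal_comp).add
      ((((Real.hasDerivAt_cos ξ).const_mul c).ofReal_comp).mul_const Complex.I)).congr_deriv ?_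
    push_cast; ring
  rw [curvature, norm_deriv_axisEllipse, h2, h1]
  congr 1
  simp [-Complex.ofReal_mul, -Complex.ofReal_neg, Complex.mul_im]
  linear_combination a * c * Real.sin_sq_add_cos_sq ξ

theorem ellipse_eq_axisEllipse (e : ℝ) : ellipse e = axisEllipse 1 (Real.sqrt (1 - e ^ 2)) := by
  funext ξ
  simp [ellipse, axisEllipse]

theorem curvature_axisEllipse_zero {a c : ℝ} (hc : 0 < c) :
    curvature (axisEllipse a c) 0 = a / c ^ 2 := by
  rw [curvature_axisEllipse, axisSpeed_zero hc]
  field_simp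

theorem curvature_axisEllipse_pi_div_two {a c : ℝ} (ha : 0 < a) :
    curvature (axisEllipse a c) (Real.pi / 2) = c / a ^ 2 := by
  have h : axisSpeed a c (Real.pi / 2) = a := by simp [axisSpeed, Real.sqrt_sq ha.le]
  rw [curvature_axisEllipse, h]
  field_simp

theorem mainTheorem4 (E h μ ω e : ℝ) (hE : 0 < E) (hμ : 0 < μ) (hω : 0 < ω) (hEh : 0 < E + h)
    (hHill : ω ^ 2 < 2 * E) (he0 : 0 ≤ e) (he1 : e < 1) :
    ∀ ξ Δ : ℝ, (ξ = 0 ∧ Δ = delta0 E h μ ω e) ∨ (ξ = Real.pi / 2 ∧ Δ = delta1 E h μ ω e) →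
      HasHomotheticOrbit E h μ ω (ellipseDomain e) (ellipse e) ξ ∧
      (∃ F, IsLocalReturnMap E h μ ω (ellipseDomain e) (ellipse e) (ξ, 0) F) ∧
      deltaGeneral E h μ ω (ellipse e) ξ = Δ ∧
      ∀ F, IsLocalReturnMap E h μ ω (ellipseDomain e) (ellipse e) (ξ, 0) F →
        DifferentiableAt ℝ F (ξ, 0) ∧
        charDiscr (fderiv ℝ F (ξ, 0)) = Δ ∧
        (0 < Δ ↔ IsSaddle (fderiv ℝ F (ξ, 0))) ∧
        (Δ < 0 ↔ IsCenter (fderiv ℝ F (ξ, 0))) ∧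
        (0 < Δ → ¬ IsLinearlyStable (fderiv ℝ F (ξ, 0))) ∧
        (Δ < 0 → IsLinearlyStable (fderiv ℝ F (ξ, 0))) := by
  have he2 : 0 < 1 - e ^ 2 := by nlinarith
  obtain ⟨b, hb0, hb2, hb⟩ : ∃ b : ℝ, 0 < b ∧ b ^ 2 = 1 - e ^ 2 ∧ Real.sqrt (1 - e ^ 2) = b :=
    ⟨_, Real.sqrt_pos.mpr he2, Real.sq_sqrt he2.le, rfl⟩
  have hb1 : b ≤ 1 := by nlinarith [sq_nonneg e]
  have hell : ellipse e = axisEllipse 1 b := by rw [ellipse_eq_axisEllipse, hb]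
  have h0 : ellipse e 0 = ((1 : ℝ) : ℂ) := by rw [hell, axisEllipse_zero]
  have h1 : ellipse e (Real.pi / 2) = (b : ℂ) * Complex.I := by rw [hell]; simp [axisEllipse]
  have n0 : ‖ellipse e 0‖ = 1 := by rw [h0]; simp
  have n1 : ‖ellipse e (Real.pi / 2)‖ = b := by rw [h1]; simp [abs_of_pos hb0]
  -- The condition `ω² < 2E` makes the outer potential positive at distance at most `1` from the
  -- origin, hence at both vertices.
  have pE : ∀ {a : ℝ}, 0 < a → a ≤ 1 → 0 < outerPotential E ω (a : ℂ) := fun ha ha1 => by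
    simp only [outerPotential, Complex.norm_real, Real.norm_eq_abs, sq_abs]
    have : ω ^ 2 * _ ^ 2 ≤ ω ^ 2 * 1 :=
      mul_le_mul_of_nonneg_left (pow_le_one₀ (n := 2) ha.le ha1) (sq_nonneg ω)
    linarith
  have pI : ∀ {a : ℝ}, 0 < a → 0 < innerPotential E h μ (a : ℂ) := fun ha => by
    simp only [innerPotential, Complex.norm_real, Real.norm_eq_abs, abs_of_pos ha]
    have := div_pos hμ ha
    linarith
  rintro ξ Δ (⟨rfl, rfl⟩ | ⟨rfl, rfl⟩)
  · have eE : outerPotential E ω (ellipse e 0) = outerPotential E ω ((1 : ℝ) : ℂ) := by rw [h0]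
    have eI : innerPotential E h μ (ellipse e 0) = innerPotential E h μ ((1 : ℝ) : ℂ) := by rw [h0]
    have gE := pE one_pos le_rfl
    have gI := pI one_pos
    -- This is `κ` at the vertex on the axis of length `1`, where the curvature is `1 / b²`.
    have hee : e ^ 2 / (1 - e ^ 2) = 1 ^ 2 / b ^ 2 - 1 := by
      rw [hb2]
      field_simp
      ring
    have hΔ : deltaGeneral E h μ ω (ellipse e) 0 = delta0 E h μ ω e := by
      simp only [deltaGeneral, delta0, n0, hee]
      rw [hell, curvature_axisEllipse_zero hb0]
      ring
    obtain ⟨H1, H2, H3⟩ := homothetic_stability (δ := 0) (D := ellipseDomain e) (γ := ellipse e)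
      (s := 1) hE hμ hω hEh one_pos hb0
      (Real.sqrt_pos.mpr gE) (Real.sqrt_pos.mpr gI) (Real.sq_sqrt gE.le) (Real.sq_sqrt gI.le)
      norm_one (fun ξ => by rw [hell]; simp)
      (fun z => by simp [ellipseDomain, axisDomain, axisForm, hb2]) (Δ := delta0 E h μ ω e)
      (by
        simp only [delta0, hee, eE, eI]
        ring)
    exact ⟨H1, H2, hΔ, H3⟩
  · have eE : outerPotential E ω (ellipse e (Real.pi / 2)) = outerPotential E ω (b : ℂ) := by
      simp only [outerPotential, n1, Complex.norm_real, Real.norm_eq_abs, abs_of_pos hb0]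
    have eI : innerPotential E h μ (ellipse e (Real.pi / 2)) = innerPotential E h μ (b : ℂ) := by
      simp only [innerPotential, n1, Complex.norm_real, Real.norm_eq_abs, abs_of_pos hb0]
    have gE := pE hb0 hb1
    have gI := pI hb0
    have hee : e ^ 2 = 1 - b ^ 2 := by rw [hb2]; ring
    have hΔ : deltaGeneral E h μ ω (ellipse e) (Real.pi / 2) = delta1 E h μ ω e := by
      simp only [deltaGeneral, delta1, n1, hb]
      rw [hell, curvature_axisEllipse_pi_div_two one_pos, hee]
      ring
    -- A square root of `I` realises the quarter turn, which carries the ellipse with semiaxes `b`,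
    -- `1` to the given one. There `κ = b² - 1 = -e²`.
    obtain ⟨s, hs⟩ := IsAlgClosed.exists_pow_nat_eq Complex.I two_pos
    have hs1 : ‖s‖ = 1 := by
      refine (pow_eq_one_iff_of_nonneg (norm_nonneg _) two_ne_zero).mp ?_
      rw [← norm_pow, hs, Complex.norm_I]
    obtain ⟨H1, H2, H3⟩ := homothetic_stability (δ := Real.pi / 2) (D := ellipseDomain e)
      (γ := ellipse e) (s := s) hE hμ hω hEh hb0 one_pos
      (Real.sqrt_pos.mpr gE) (Real.sqrt_pos.mpr gI) (Real.sq_sqrt gE.le) (Real.sq_sqrt gI.le)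
      hs1 (fun ξ => by
        rw [hell, hs]
        apply Complex.ext <;> simp [Real.cos_sub_pi_div_two, Real.sin_sub_pi_div_two])
      (fun z => by
        rw [hs]
        simp [ellipseDomain, axisDomain, axisForm, hb2, add_comm]) (Δ := delta1 E h μ ω e)
      (by
        simp only [delta1, hb, eE, eI]
        rw [hee]
        ring)
    exact ⟨H1, H2, hΔ, H3⟩
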